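/- Conventions. For a unit vector $\mathbf v\in\mathbb R^2$ and $\ell\in(0,1)$, the cone with axis $\mathbb R\mathbf v$ and coefficient $\ell$ is $K=\{\mathbf u\in\mathbb R^2: |\mathbf u\cdot\mathbf v|\ge \ell\|\mathbf u\|\}$ (Euclidean norm). A pair of cones $K^u,K^s$ is universal if $K^u\cap K^s=\{\mathbf 0\}$, the axis of $K^u$ is the $x$-axis and the axis of $K^s$ is the $y$-axis. A cone-field assigns to each $P\in\mathbb R^2$ a cone whose axis and coefficient depend continuously on $P$. An arc is a homeomorphic image of $[0,1]$ in the plane; it is smooth if it has an injective $C^1$ parametrization $[0,1]\to\mathbb R^2$ with nowhere vanishing derivative. Let $F_1,F_2:\mathbb R^2\to\mathbb R^2$ be synchronously hyperbolic $C^1$ diffeomorphisms. That is, either both reverse or both preserve orientation, and there are a number $\lambda>1$ (the stretching factor), a universal pair of cones $K^u,K^s$, and cone-fields $(K^u_P)$, $(K^s_P)$ such that for $i=1,2$: (S1) for every $P$: $K^u_P\subset K^u$, $K^s_P\subset K^s$, $(DF_i)_P(K^u_P)\subset K^u_{F_i(P)}$ and $(DF_i^{-1})_P(K^s_P)\subset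 K^s_{F_i^{-1}(P)}$; (S2) for every $P$: $\|(DF_i)_P\mathbf u\|\ge\lambda\|\mathbf u\|$ for $\mathbf u\in K^u_P$ and $\|(DF_i^{-1})_P\mathbf w\|\ge\lambda\|\mathbf w\|$ for $\mathbf w\in K^s_P$; (S3) there is a $C^1$ curve $\Gamma=\{(g(y),y):y\in\mathbb R\}$ (the divider) such that for every $P\in\Gamma$ we have $F_1(P)=F_2(P)$, the tangent vector to $\Gamma$ at $P$ belongs to $K^s_P$, and the tangent vector to $F_i(\Gamma)$ at $F_i(P)$ belongs to $K^u_{F_i(P)}$. The left and the right half-plane are the sets $\{x\le g(y)\}$ and $\{x\ge g(y)\}$. Let $F=F_1$ on the left half-plane and $F=F_2$ on the right half-plane. Assume that $F$ is Lozi-like, that is: (L1) $-1<\det (DF_i)_P<0$ for all $P\in\mathbb R^2$ and $i=1,2$; (L2) there is a nonempty set $\Delta$, homeomorphic to an open disk and with closure homeomorphic to a closed disk, such that $F(\operatorname{Cl}\Delta)\subset\operatorname{Int}\Delta$. Let $X\in\Delta$ be a fixed point of $F$ that lies in the right half-plane. For a map $f$ fixing $X$, write $W^u_f(X)$ for its unstable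 manifold at $X$ (the points with a backward orbit converging to $X$) and $W^s_f(X)$ for its stable manifold at $X$ (the points whose forward orbit converges to $X$). Let $D$ be the point of $\Gamma\cap W^u_{F_2}(X)$ and $M$ the point of $\Gamma\cap W^s_{F_2}(X)$. Assume further: (L3) the arc with boundary points $F^3(D),F(D)$ contained in $W^u_F(X)$ intersects the arc with boundary points $X,M$ contained in $W^s_F(X)$; (L4) $\lambda>\sqrt2$. Theorem. Let $A\subset W^u_F(X)$ be an arc. Then there exist $n\ge0$ and a smooth arc $\hat A\subset F^n(A)$ such that $\hat A$ intersects both $\Gamma$ and $F(\Gamma)$. -/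

import Mathlib

open Set Filter Topology
open scoped Manifold ContDiff

/-- The Euclidean plane. -/
abbrev Plane := EuclideanSpace ℝ (Fin 2)

/-- `C¹` diffeomorphisms of the plane onto itself. -/
abbrev PlaneDiffeo := Diffeomorph 𝓘(ℝ, Plane) 𝓘(ℝ, Plane) Plane Plane 1

/-- A cone, given by a unit vector and a coefficient in `(0,1)`. -/
structure Cone where
  dir : Plane
  coeff : ℝ
  norm_dir : ‖dir‖ = 1
  coeff_pos : 0 < coeff
  coeff_lt_one : coeff < 1

namespace Cone

/-- The set of vectors `u` with `|u · v| ≥ ℓ ‖u‖`. -/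
def carrier (K : Cone) : Set Plane :=
  {u | K.coeff * ‖u‖ ≤ |inner ℝ u K.dir|}

/-- The axis of a cone, the line spanned by its unit vector. -/
def axis (K : Cone) : Submodule ℝ Plane :=
  Submodule.span ℝ {K.dir}

end Cone

/-- A universal pair of cones: the two cones meet only in `0`, the axis of the first is the
`x`-axis, the axis of the second is the `y`-axis. -/
structure IsUniversalPair (Ku Ks : Cone) : Prop where
  disjoint : Ku.carrier ∩ Ks.carrier = {0}
  axis_u : Ku.axis = Submodule.span ℝ {(!₂[1, 0] : Plane)}
  axis_s : Ks.axis = Submodule.span ℝ {(!₂[0, 1] : Plane)}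

/-- A cone-field on the whole plane. The axis is given by a continuous unit vector field; since
the plane is simply connected, every continuous field of lines is of this form. -/
structure ConeField where
  cone : Plane → Cone
  continuous_dir : Continuous fun P => (cone P).dir
  continuous_coeff : Continuous fun P => (cone P).coeff

/-- Invariance of the cone-fields under `F` and `F⁻¹`, and stretching by the factor `lam` of the
unstable cones under `DF` and of the stable cones under `DF⁻¹`. -/
structure IsConeHyperbolic (F : PlaneDiffeo) (lam : ℝ) (Cu Cs : ConeField) : Prop where
  map_u : ∀ P, ∀ u ∈ (Cu.cone P).carrier, fderiv ℝ F P u ∈ (Cu.cone (F P)).carrier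
  map_s : ∀ P, ∀ w ∈ (Cs.cone P).carrier,
    fderiv ℝ F.symm P w ∈ (Cs.cone (F.symm P)).carrier
  stretch_u : ∀ P, ∀ u ∈ (Cu.cone P).carrier, lam * ‖u‖ ≤ ‖fderiv ℝ F P u‖
  stretch_s : ∀ P, ∀ w ∈ (Cs.cone P).carrier, lam * ‖w‖ ≤ ‖fderiv ℝ F.symm P w‖

/-- A pair of synchronously hyperbolic `C¹` diffeomorphisms, together with the stretching factor,
the universal pair of cones, the cone-fields and the divider. The divider is a smooth curve, infinite
in both directions, with tangent vectors in the stable cones; so it is the graph `x = g y` of a `C¹`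
function `g` on the whole line, with tangent vector `(g' y, 1)` at `(g y, y)`. -/
structure SynchronouslyHyperbolic where
  F₁ : PlaneDiffeo
  F₂ : PlaneDiffeo
  /-- Both orientation reversing, or both orientation preserving. -/
  orientation : (∀ P, (fderiv ℝ F₁ P).det < 0 ∧ (fderiv ℝ F₂ P).det < 0) ∨
    (∀ P, 0 < (fderiv ℝ F₁ P).det ∧ 0 < (fderiv ℝ F₂ P).det)
  /-- The stretching factor. -/
  lam : ℝ
  one_lt_lam : 1 < lam
  Ku : Cone
  Ks : Cone
  universal : IsUniversalPair Ku Ks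
  Cu : ConeField
  Cs : ConeField
  Cu_subset : ∀ P, (Cu.cone P).carrier ⊆ Ku.carrier
  Cs_subset : ∀ P, (Cs.cone P).carrier ⊆ Ks.carrier
  hyp₁ : IsConeHyperbolic F₁ lam Cu Cs
  hyp₂ : IsConeHyperbolic F₂ lam Cu Cs
  /-- The function whose graph `x = g y` is the divider. -/
  g : ℝ → ℝ
  g_smooth : ContDiff ℝ 1 g
  agree : ∀ y, F₁ !₂[g y, y] = F₂ !₂[g y, y]
  tangent_s : ∀ y, (!₂[deriv g y, 1] : Plane) ∈ (Cs.cone !₂[g y, y]).carrier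
  tangent_u₁ : ∀ y,
    fderiv ℝ F₁ !₂[g y, y] !₂[deriv g y, 1] ∈ (Cu.cone (F₁ !₂[g y, y])).carrier
  tangent_u₂ : ∀ y,
    fderiv ℝ F₂ !₂[g y, y] !₂[deriv g y, 1] ∈ (Cu.cone (F₂ !₂[g y, y])).carrier

namespace SynchronouslyHyperbolic

/-- The divider, as a subset of the plane. -/
def divider (S : SynchronouslyHyperbolic) : Set Plane := {P | P 0 = S.g (P 1)}

/-- The left half-plane, including the divider. -/
def leftHalfPlane (S : SynchronouslyHyperbolic) : Set Plane := {P | P 0 ≤ S.g (P 1)}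

/-- The right half-plane, including the divider. -/
def rightHalfPlane (S : SynchronouslyHyperbolic) : Set Plane := {P | S.g (P 1) ≤ P 0}

open Classical in
/-- The map equal to `F₁` on the left half-plane and to `F₂` on the right half-plane (on the
divider `F₁ = F₂`). -/
noncomputable def map (S : SynchronouslyHyperbolic) (P : Plane) : Plane :=
  if P ∈ S.leftHalfPlane then S.F₁ P else S.F₂ P

end SynchronouslyHyperbolic

/-- A trapping region: a nonempty set that is mapped with its closure into its interior. -/
def IsTrappingRegion (f : Plane → Plane) (U : Set Plane) : Prop :=
  U.Nonempty ∧ f '' closure U ⊆ interior U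

/-- A Lozi-like map with a trapping region. -/
structure LoziLike extends SynchronouslyHyperbolic where
  det₁ : ∀ P, -1 < (fderiv ℝ F₁ P).det ∧ (fderiv ℝ F₁ P).det < 0
  det₂ : ∀ P, -1 < (fderiv ℝ F₂ P).det ∧ (fderiv ℝ F₂ P).det < 0
  /-- The trapping region. -/
  Δ : Set Plane
  trapping : IsTrappingRegion toSynchronouslyHyperbolic.map Δ
  open_disk : Nonempty (Δ ≃ₜ Metric.ball (0 : Plane) 1)
  closed_disk : Nonempty (closure Δ ≃ₜ Metric.closedBall (0 : Plane) 1)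

/-- The unstable manifold of `f` at a fixed point `X`: the points with a backward orbit converging
to `X` (if `f` is a bijection, the points `P` with `f⁻ⁿ(P) → X`). -/
def unstableManifold (f : Plane → Plane) (X : Plane) : Set Plane :=
  {P | ∃ q : ℕ → Plane, q 0 = P ∧ (∀ n, f (q (n + 1)) = q n) ∧ Tendsto q atTop (𝓝 X)}

/-- The stable manifold of `f` at a fixed point `X`. -/
def stableManifold (f : Plane → Plane) (X : Plane) : Set Plane :=
  {P | Tendsto (fun n : ℕ => f^[n] P) atTop (𝓝 X)}

/-- `A` is an arc (a homeomorphic image of `[0,1]`) with boundary points `P` and `Q`. -/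
def IsArcBetween (P Q : Plane) (A : Set Plane) : Prop :=
  ∃ γ : ℝ → Plane, ContinuousOn γ (Icc 0 1) ∧ InjOn γ (Icc 0 1) ∧
    γ 0 = P ∧ γ 1 = Q ∧ γ '' Icc 0 1 = A

/-- `A` is an arc. -/
def IsArc (A : Set Plane) : Prop := ∃ P Q, IsArcBetween P Q A

/-- `A` is a smooth arc: it has an injective `C¹` parametrization with nonzero tangent vectors. -/
def IsSmoothArc (A : Set Plane) : Prop :=
  ∃ γ : ℝ → Plane, ContDiffOn ℝ 1 γ (Icc 0 1) ∧ InjOn γ (Icc 0 1) ∧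
    (∀ t ∈ Icc (0 : ℝ) 1, derivWithin γ (Icc 0 1) t ≠ 0) ∧ γ '' Icc 0 1 = A

/-- Condition (L3) for the fixed point `X` in the right half-plane: with `D` and `M` the points where
the unstable and the stable manifold of `F₂` at `X` meet the divider, the arc with boundary points
`F³(D)`, `F(D)` in the unstable manifold of `F` at `X` intersects the arc with boundary points `X`, `M`
in the stable manifold of `F` at `X`. -/
def LoziLike.L3 (L : LoziLike) (X : Plane) : Prop :=
  ∃ D ∈ L.divider ∩ unstableManifold L.F₂ X,
  ∃ M ∈ L.divider ∩ stableManifold L.F₂ X,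
  ∃ B S : Set Plane,
    IsArcBetween (L.map^[3] D) (L.map D) B ∧ B ⊆ unstableManifold L.map X ∧
    IsArcBetween X M S ∧ S ⊆ stableManifold L.map X ∧
    (B ∩ S).Nonempty

/-- Condition (L4): the stretching factor is larger than `√2`. -/
def LoziLike.L4 (L : LoziLike) : Prop := √2 < L.lam

/-! The proof plays length against boundedness. An unstable curve (`C¹`, velocities in the unstable
cones) meets the divider Γ at most once, because the tangents of Γ are stable, and on either side of
Γ the map stretches it by λ. Suppose no iterate of `A` contains the required arc. A curve that
misses Γ is mapped as a whole. A curve that crosses Γ is cut there and the longer part is kept; its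
image has an endpoint on F(Γ), so by assumption it misses Γ and can be mapped once more without a
cut. Each round multiplies a lower bound for the length by at least min(λ, λ²/2) > 1
(`exists_long_curve`). But all iterates of `A` stay in the bounded set Cl Δ, and horizontal extent
controls this bound: a contradiction.

The iteration needs an unstable curve inside `A`, which is only a topological arc. Condition (L3)
keeps `X` off Γ, so F = F₂ near `X`. The local unstable manifold of F₂ comes from the inverse
function theorem in the space of bounded sequences (`exists_local_unstable_curve`), and its tangents
lie in the unstable cones (`IsConeHyperbolic.mem_of_bounded_backward`). Its iterates, cut at Γ,
cover the unstable manifold by countably many unstable curves, and by Baire's theorem one of them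
shares a subarc with `A`. -/

open scoped BoundedContinuousFunction

/-! ### Superposition operators on bounded sequences. -/

section Nemytskii

variable {E W : Type*} [NormedAddCommGroup E] [NormedAddCommGroup W]

section Continuous

variable [ProperSpace E]

theorem exists_norm_comp_le {H : E → W} (hH : Continuous H) (x : ℕ →ᵇ E) :
    ∃ C, ∀ n, ‖H (x n)‖ ≤ C := by
  obtain ⟨C, hC⟩ := (isCompact_closedBall (0 : E) ‖x‖).exists_bound_of_continuousOn
    hH.continuousOn
  exact ⟨C, fun n => hC _ (by simpa using x.norm_coe_le_norm n)⟩

/-- The superposition operator on bounded sequences given by a continuous map. -/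
noncomputable def superposition (H : E → W) (hH : Continuous H) (x : ℕ →ᵇ E) : ℕ →ᵇ W :=
  BoundedContinuousFunction.ofNormedAddCommGroupDiscrete (fun n => H (x n))
    (exists_norm_comp_le hH x).choose (exists_norm_comp_le hH x).choose_spec

@[simp] theorem superposition_apply (H : E → W) (hH : Continuous H) (x : ℕ →ᵇ E) (n : ℕ) :
    superposition H hH x n = H (x n) := rfl

/-- The terms of `x` lie in one compact ball; uniform continuity on a slightly larger ball makes `δ`
independent of `n`. -/
theorem exists_modulus {H : E → W} (hH : Continuous H) (x : ℕ →ᵇ E) {ε : ℝ} (hε : 0 < ε) :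
    ∃ δ > 0, ∀ n, ∀ z ∈ Metric.ball (x n) δ, ‖H z - H (x n)‖ ≤ ε := by
  have huc := (isCompact_closedBall (0 : E) (‖x‖ + 1)).uniformContinuousOn_of_continuous
    hH.continuousOn
  obtain ⟨δ, hδ, h⟩ := Metric.uniformContinuousOn_iff.1 huc ε hε
  refine ⟨min δ 1, by positivity, fun n z hz => ?_⟩
  have hx : ‖x n‖ ≤ ‖x‖ := x.norm_coe_le_norm n
  have hz' := lt_min_iff.1 (Metric.mem_ball.1 hz)
  have hz1 : ‖z - x n‖ < 1 := by simpa [dist_eq_norm] using hz'.2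
  have hzn : ‖z‖ ≤ ‖x‖ + 1 := by
    have := norm_add_le (z - x n) (x n)
    rw [sub_add_cancel] at this
    linarith
  have := h z (by simpa using hzn) (x n) (by simp; linarith) hz'.1
  rw [dist_eq_norm] at this
  exact this.le

theorem continuous_superposition {H : E → W} (hH : Continuous H) :
    Continuous (superposition H hH) := by
  rw [Metric.continuous_iff]
  intro x ε hε
  obtain ⟨δ, hδ, h⟩ := exists_modulus hH x (half_pos hε)
  refine ⟨δ, hδ, fun y hy => ?_⟩
  refine lt_of_le_of_lt ?_ (half_lt_self hε)
  rw [BoundedContinuousFunction.dist_le (half_pos hε).le]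
  intro n
  rw [dist_eq_norm]
  exact h n _ (lt_of_le_of_lt (BoundedContinuousFunction.dist_coe_le_dist n) hy)

end Continuous

variable [NormedSpace ℝ E] [NormedSpace ℝ W]

/-- Pointwise application of a bounded sequence of operators to a bounded sequence of vectors. -/
noncomputable def pointwiseApply :
    (ℕ →ᵇ (E →L[ℝ] W)) →L[ℝ] (ℕ →ᵇ E) →L[ℝ] (ℕ →ᵇ W) :=
  LinearMap.mkContinuous₂
    (LinearMap.mk₂ ℝ
      (fun (A : ℕ →ᵇ (E →L[ℝ] W)) (v : ℕ →ᵇ E) =>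
        BoundedContinuousFunction.ofNormedAddCommGroupDiscrete (fun n => A n (v n))
        (‖A‖ * ‖v‖) fun n => (A n).le_of_opNorm_le_of_le (A.norm_coe_le_norm n)
          (v.norm_coe_le_norm n))
      (fun _ _ _ => by ext; simp) (fun _ _ _ => by ext; simp)
      (fun _ _ _ => by ext; simp) (fun _ _ _ => by ext; simp))
    1 (fun A v => by
      rw [one_mul]
      exact BoundedContinuousFunction.norm_ofNormedAddCommGroup_le _ (by positivity)
        fun n => (A n).le_of_opNorm_le_of_le (A.norm_coe_le_norm n) (v.norm_coe_le_norm n))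

@[simp] theorem pointwiseApply_apply (A : ℕ →ᵇ (E →L[ℝ] W)) (v : ℕ →ᵇ E) (n : ℕ) :
    pointwiseApply A v n = A n (v n) := rfl

variable [ProperSpace E]

/-- The mean value inequality bounds the remainder at each index by the oscillation of `fderiv ℝ H`
near `x n`, which `exists_modulus` makes small uniformly in `n`. -/
theorem hasFDerivAt_superposition {H : E → W} (hH : ContDiff ℝ 1 H) (x : ℕ →ᵇ E) :
    HasFDerivAt (superposition H hH.continuous)
      (pointwiseApply (superposition (fderiv ℝ H) (hH.continuous_fderiv one_ne_zero) x)) x := by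
  rw [hasFDerivAt_iff_isLittleO, Asymptotics.isLittleO_iff]
  intro ε hε
  obtain ⟨δ, hδ, h⟩ := exists_modulus (hH.continuous_fderiv one_ne_zero) x hε
  filter_upwards [Metric.ball_mem_nhds x hδ] with y hy
  rw [BoundedContinuousFunction.norm_le (by positivity)]
  intro n
  have hd : y n ∈ Metric.ball (x n) δ :=
    lt_of_le_of_lt (BoundedContinuousFunction.dist_coe_le_dist n) hy
  have key := (convex_ball (x n) δ).norm_image_sub_le_of_norm_fderiv_le' (𝕜 := ℝ) (f := H)
    (fun z _ => hH.differentiable one_ne_zero z) (h n) (Metric.mem_ball_self hδ) hd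
  calc _ = ‖H (y n) - H (x n) - fderiv ℝ H (x n) (y n - x n)‖ := by simp
    _ ≤ ε * ‖y n - x n‖ := key
    _ ≤ ε * ‖y - x‖ := by
      gcongr
      exact (y - x).norm_coe_le_norm n

theorem contDiff_superposition {H : E → W} (hH : ContDiff ℝ 1 H) :
    ContDiff ℝ 1 (superposition H hH.continuous) :=
  contDiff_one_iff_hasFDerivAt.2 ⟨_, pointwiseApply.continuous.comp
    (continuous_superposition (hH.continuous_fderiv one_ne_zero)), hasFDerivAt_superposition hH⟩

end Nemytskii

/-! ### Bounded solutions of scalar linear recursions. -/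

section Recursion

/-- In the expanding direction each step divides by `μ`, so every initial value `t` gives a bounded
solution. -/
theorem exists_bounded_forward {μ : ℝ} (hμ : 1 < |μ|) {h : ℕ → ℝ} {H : ℝ} (hH : ∀ n, |h n| ≤ H)
    (t : ℝ) : ∃ u : ℕ → ℝ, u 0 = t ∧ (∀ n, μ * u (n + 1) - u n = h n) ∧ ∃ C, ∀ n, |u n| ≤ C := by
  have hμ0 : μ ≠ 0 := by rintro rfl; norm_num at hμ
  let u : ℕ → ℝ := fun n => Nat.rec t (fun k r => (r + h k) / μ) n
  have hu : ∀ n, u (n + 1) = (u n + h n) / μ := fun n => rfl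
  have hH0 : 0 ≤ H := (abs_nonneg _).trans (hH 0)
  -- `H / (|μ| - 1)` is the fixed point of `r ↦ (r + H) / |μ|`; adding `|t|` covers the initial
  -- value.
  refine ⟨u, rfl, fun n => by rw [hu]; field_simp; ring, |t| + H / (|μ| - 1), fun n => ?_⟩
  have hpos : 0 < |μ| - 1 := by linarith
  induction n with
  | zero =>
    change |t| ≤ _
    have : 0 ≤ H / (|μ| - 1) := by positivity
    linarith
  | succ n ih =>
    rw [hu, abs_div, div_le_iff₀ (by linarith)]
    have h1 := abs_add_le (u n) (h n)
    have h2 := hH n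
    have h3 : H / (|μ| - 1) * (|μ| - 1) = H := by field_simp
    nlinarith [abs_nonneg t]

/-- In the contracting direction the initial value is not free: the bounded solution is the series
obtained by unrolling the recursion to infinity. This also covers `ν = 0`. -/
theorem exists_bounded_backward {ν : ℝ} (hν : |ν| < 1) {h : ℕ → ℝ} {H : ℝ}
    (hH : ∀ n, |h n| ≤ H) :
    ∃ s : ℕ → ℝ, (∀ n, ν * s (n + 1) - s n = h n) ∧ ∃ C, ∀ n, |s n| ≤ C := by
  have hg : Summable fun k => |ν| ^ k * H :=
    (summable_geometric_of_lt_one (abs_nonneg _) hν).mul_right H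
  have hb : ∀ n k, ‖ν ^ k * h (n + k)‖ ≤ |ν| ^ k * H := fun n k => by
    rw [Real.norm_eq_abs, abs_mul, abs_pow]
    gcongr
    exact hH _
  have hs : ∀ n, Summable fun k => ν ^ k * h (n + k) := fun n =>
    Summable.of_norm_bounded hg (hb n)
  refine ⟨fun n => -∑' k, ν ^ k * h (n + k), fun n => ?_, ∑' k, |ν| ^ k * H, fun n => ?_⟩
  · beta_reduce
    rw [(hs n).tsum_eq_zero_add, mul_neg, ← tsum_mul_left]
    simp only [pow_zero, one_mul, add_zero, pow_succ']
    have : (fun k => ν * (ν ^ k * h (n + 1 + k))) = fun k => ν * ν ^ k * h (n + (k + 1)) := by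
      funext k
      rw [mul_assoc, add_right_comm, add_assoc]
    rw [this]
    ring
  · rw [abs_neg]
    exact tsum_of_norm_bounded hg.hasSum (hb n)

theorem eq_zero_of_bounded_backward {ν : ℝ} (hν : |ν| < 1) {s : ℕ → ℝ} {C : ℝ}
    (hC : ∀ n, |s n| ≤ C) (h : ∀ n, s n = ν * s (n + 1)) (n : ℕ) : s n = 0 := by
  have hk : ∀ k n, s n = ν ^ k * s (n + k) := fun k => by
    induction k with
    | zero => simp
    | succ k ih => intro n; rw [ih n, h (n + k), pow_succ, mul_assoc, add_assoc]
  have hlim : Tendsto (fun k => |ν| ^ k * C) atTop (𝓝 (0 * C)) :=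
    (tendsto_pow_atTop_nhds_zero_of_lt_one (abs_nonneg _) hν).mul_const C
  rw [zero_mul] at hlim
  refine abs_nonpos_iff.1 (ge_of_tendsto' hlim fun k => ?_)
  rw [hk k n, abs_mul, abs_pow]
  gcongr
  exact hC _

end Recursion

/-! ### Local unstable manifold through spaces of backward orbits. -/

section LocalUnstable

variable {E : Type*} [NormedAddCommGroup E] [NormedSpace ℝ E]

/-- The left shift on bounded sequences. -/
noncomputable def leftShift (E : Type*) [NormedAddCommGroup E] [NormedSpace ℝ E] :
    (ℕ →ᵇ E) →L[ℝ] (ℕ →ᵇ E) :=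
  BoundedContinuousFunction.compContinuousCLM E ℝ ⟨fun n => n + 1, continuous_of_discreteTopology⟩

@[simp] theorem leftShift_apply (x : ℕ →ᵇ E) (n : ℕ) : leftShift E x n = x (n + 1) := rfl

variable [ProperSpace E]

/-- The map whose value is `(t, 0)` exactly at the backward orbits `x` of `G` with `π (x 0) = t`. -/
noncomputable def backwardOrbitMap (π : E →L[ℝ] ℝ) {G : E → E} (hG : ContDiff ℝ 1 G)
    (x : ℕ →ᵇ E) : ℝ × (ℕ →ᵇ E) :=
  (π (x 0), superposition G hG.continuous (leftShift E x) - x)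

theorem contDiff_backwardOrbitMap (π : E →L[ℝ] ℝ) {G : E → E} (hG : ContDiff ℝ 1 G) :
    ContDiff ℝ 1 (backwardOrbitMap π hG) := by
  refine ContDiff.prodMk ?_ ?_
  · exact (π.comp (BoundedContinuousFunction.evalCLM ℝ (0 : ℕ))).contDiff
  · exact ((contDiff_superposition hG).comp (leftShift E).contDiff).sub contDiff_id

/-- The derivative of `backwardOrbitMap`. -/
noncomputable def backwardOrbitDeriv (π : E →L[ℝ] ℝ) {G : E → E} (hG : ContDiff ℝ 1 G)
    (x : ℕ →ᵇ E) : (ℕ →ᵇ E) →L[ℝ] ℝ × (ℕ →ᵇ E) :=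
  (π.comp (BoundedContinuousFunction.evalCLM ℝ (0 : ℕ))).prod
    ((pointwiseApply (superposition (fderiv ℝ G) (hG.continuous_fderiv one_ne_zero)
      (leftShift E x))).comp (leftShift E) - ContinuousLinearMap.id ℝ _)

theorem hasFDerivAt_backwardOrbitMap (π : E →L[ℝ] ℝ) {G : E → E} (hG : ContDiff ℝ 1 G)
    (x : ℕ →ᵇ E) :
    HasFDerivAt (backwardOrbitMap π hG) (backwardOrbitDeriv π hG x) x := by
  refine HasFDerivAt.prodMk ?_ ?_
  · exact (π.comp (BoundedContinuousFunction.evalCLM ℝ (0 : ℕ))).hasFDerivAt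
  · exact ((hasFDerivAt_superposition hG _).comp x (leftShift E).hasFDerivAt).sub
      (hasFDerivAt_id x)

/-- In the eigenbasis the linearized equation splits into two scalar recursions: the expanding one
is determined by its initial value, the contracting one has exactly one bounded solution. -/
theorem bijective_backwardOrbitDeriv {G : E → E} (hG : ContDiff ℝ 1 G)
    (b : Module.Basis (Fin 2) ℝ E) {μ ν : ℝ} (h0 : fderiv ℝ G 0 (b 0) = μ • b 0)
    (h1 : fderiv ℝ G 0 (b 1) = ν • b 1) (hμ : 1 < |μ|) (hν : |ν| < 1) (π : E →L[ℝ] ℝ)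
    (hπ : ∀ v, π v = b.repr v 0) :
    Function.Bijective (backwardOrbitDeriv π hG 0) := by
  have : FiniteDimensional ℝ E := Module.Finite.of_basis b
  have hμ0 : μ ≠ 0 := by rintro rfl; norm_num at hμ
  have hcoord : ∀ i : Fin 2, ∃ K, ∀ v, |b.repr v i| ≤ K * ‖v‖ := fun i => by
    refine ⟨‖LinearMap.toContinuousLinearMap (b.coord i)‖, fun v => ?_⟩
    simpa using (LinearMap.toContinuousLinearMap (b.coord i)).le_opNorm v
  have hdec : ∀ v, v = b.repr v 0 • b 0 + b.repr v 1 • b 1 := fun v => by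
    conv_lhs => rw [← b.sum_repr v, Fin.sum_univ_two]
  have hT0 : ∀ v, b.repr (fderiv ℝ G 0 v) 0 = μ * b.repr v 0 := fun v => by
    conv_lhs => rw [hdec v]
    simp [h0, h1, mul_comm]
  have hT1 : ∀ v, b.repr (fderiv ℝ G 0 v) 1 = ν * b.repr v 1 := fun v => by
    conv_lhs => rw [hdec v]
    simp [h0, h1, mul_comm]
  have hbound : ∀ (x : ℕ →ᵇ E) (i : Fin 2), ∃ C, ∀ n, |b.repr (x n) i| ≤ C := fun x i => by
    obtain ⟨K, hK⟩ := hcoord i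
    refine ⟨|K| * ‖x‖, fun n => (hK _).trans ?_⟩
    have := x.norm_coe_le_norm n
    calc K * ‖x n‖ ≤ |K| * ‖x n‖ := by gcongr; exact le_abs_self K
      _ ≤ _ := by gcongr
  have happ : ∀ v : ℕ →ᵇ E, backwardOrbitDeriv π hG 0 v =
      (π (v 0), (backwardOrbitDeriv π hG 0 v).2) := fun _ => rfl
  have happ2 : ∀ (v : ℕ →ᵇ E) n, (backwardOrbitDeriv π hG 0 v).2 n =
      fderiv ℝ G 0 (v (n + 1)) - v n := fun _ _ => by simp [backwardOrbitDeriv]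
  constructor
  · refine (injective_iff_map_eq_zero _).2 fun v hv => ?_
    have hv0 : π (v 0) = 0 := congrArg Prod.fst hv
    have hvn : ∀ n, fderiv ℝ G 0 (v (n + 1)) = v n := fun n => by
      rw [← sub_eq_zero, ← happ2, hv]; rfl
    have hu : ∀ n, b.repr (v n) 0 = 0 := fun n => by
      induction n with
      | zero => rw [← hπ, hv0]
      | succ n ih =>
        rw [← hvn n, hT0] at ih
        exact (mul_eq_zero.1 ih).resolve_left hμ0
    obtain ⟨C, hC⟩ := hbound v 1
    have hs := eq_zero_of_bounded_backward hν hC fun n => by rw [← hT1, hvn]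
    ext n
    rw [hdec (v n), hu, hs]
    simp
  · rintro ⟨t, h⟩
    obtain ⟨H0, hH0⟩ := hbound h 0
    obtain ⟨H1, hH1⟩ := hbound h 1
    obtain ⟨u, hu0, hu, Cu, hCu⟩ := exists_bounded_forward hμ hH0 t
    obtain ⟨s, hs, Cs, hCs⟩ := exists_bounded_backward hν hH1
    let v : ℕ →ᵇ E := BoundedContinuousFunction.ofNormedAddCommGroupDiscrete
      (fun n => u n • b 0 + s n • b 1) (Cu * ‖b 0‖ + Cs * ‖b 1‖) fun n => by
        refine (norm_add_le _ _).trans ?_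
        rw [norm_smul, norm_smul]
        gcongr
        · exact hCu n
        · exact hCs n
    have hv : ∀ n, v n = u n • b 0 + s n • b 1 := fun _ => rfl
    refine ⟨v, ?_⟩
    rw [happ]
    refine Prod.ext ?_ ?_
    · simp [hπ, hv, hu0]
    · ext n
      rw [happ2, hv, hv, map_add, map_smul, map_smul, h0, h1]
      conv_rhs => rw [hdec (h n), ← hu n, ← hs n]
      module

/-- Local unstable manifold of a planar saddle: near the fixed point `0` the bounded backward orbits
form a `C¹` curve in the space of bounded sequences. -/
theorem exists_local_unstable_curve {G : E → E} (hG : ContDiff ℝ 1 G) (hG0 : G 0 = 0)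
    (b : Module.Basis (Fin 2) ℝ E) {μ ν : ℝ} (h0 : fderiv ℝ G 0 (b 0) = μ • b 0)
    (h1 : fderiv ℝ G 0 (b 1) = ν • b 1) (hμ : 1 < |μ|) (hν : |ν| < 1) :
    ∃ δ > 0, ∃ ε > 0, ∃ x : ℝ → ℕ →ᵇ E, ContDiffOn ℝ 1 x (Ioo (-δ) δ) ∧
      (∀ t ∈ Ioo (-δ) δ, ∀ n, G (x t (n + 1)) = x t n) ∧
      (∀ t ∈ Ioo (-δ) δ, deriv x t 0 ≠ 0) ∧
      ∀ y : ℕ → E, (∀ n, ‖y n‖ ≤ ε) → (∀ n, G (y (n + 1)) = y n) →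
        ∃ t ∈ Icc (-(δ / 2)) (δ / 2), ∀ n, y n = x t n := by
  have : FiniteDimensional ℝ E := Module.Finite.of_basis b
  set π : E →L[ℝ] ℝ := LinearMap.toContinuousLinearMap (b.coord 0) with hπdef
  have hπ : ∀ v, π v = b.repr v 0 := fun v => rfl
  set Φ := backwardOrbitMap π hG with hΦ
  have hbij := bijective_backwardOrbitDeriv hG b h0 h1 hμ hν π hπ
  let D : (ℕ →ᵇ E) ≃L[ℝ] ℝ × (ℕ →ᵇ E) :=
    ContinuousLinearEquiv.ofBijective (backwardOrbitDeriv π hG 0)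
      (LinearMap.ker_eq_bot.2 hbij.1) (LinearMap.range_eq_top.2 hbij.2)
  have hΦ0 : Φ 0 = (0, 0) := by
    refine Prod.ext ?_ ?_
    · exact map_zero π
    · ext n
      simp [hΦ, backwardOrbitMap, hG0]
  have hcd : ContDiffAt ℝ 1 Φ 0 := (contDiff_backwardOrbitMap π hG).contDiffAt
  have hder : HasFDerivAt Φ (D : (ℕ →ᵇ E) →L[ℝ] ℝ × (ℕ →ᵇ E)) 0 :=
    hasFDerivAt_backwardOrbitMap π hG 0
  set e := hcd.toOpenPartialHomeomorph Φ hder one_ne_zero with he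
  have hecoe : ∀ y, e y = Φ y := fun _ => rfl
  have hsrc : (0 : ℕ →ᵇ E) ∈ e.source := hcd.mem_toOpenPartialHomeomorph_source hder one_ne_zero
  have htgt : ((0 : ℝ), (0 : ℕ →ᵇ E)) ∈ e.target := by
    rw [← hΦ0]; exact e.map_source hsrc
  have hinv : ContDiffAt ℝ 1 e.symm (0, 0) := by
    rw [← hΦ0]; exact hcd.to_localInverse hder one_ne_zero
  have hev : ∀ᶠ p in 𝓝 ((0 : ℝ), (0 : ℕ →ᵇ E)), ContDiffAt ℝ 1 e.symm p ∧ p ∈ e.target :=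
    (hinv.eventually (by simp)).and (e.open_target.mem_nhds htgt)
  have hι : Tendsto (fun t : ℝ => (t, (0 : ℕ →ᵇ E))) (𝓝 0) (𝓝 (0, 0)) :=
    Continuous.tendsto (by fun_prop) 0
  obtain ⟨δ, hδ, hball⟩ := Metric.eventually_nhds_iff.1 (hι.eventually hev)
  have hmem : ∀ t ∈ Ioo (-δ) δ, ContDiffAt ℝ 1 e.symm (t, 0) ∧ (t, 0) ∈ e.target := fun t ht =>
    hball (by simpa [abs_lt] using ht)
  have hΦx : ∀ t ∈ Ioo (-δ) δ, Φ (e.symm (t, 0)) = (t, 0) := fun t ht =>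
    e.right_inv (hmem t ht).2
  have hxcd : ContDiffOn ℝ 1 (fun t : ℝ => e.symm (t, 0)) (Ioo (-δ) δ) := fun t ht =>
    (ContDiffAt.comp t (hmem t ht).1 (contDiffAt_id.prodMk contDiffAt_const)).contDiffWithinAt
  -- The bound `δ / 2` places the parameters of small orbits in a closed interval inside the domain
  -- of the curve.
  have hev2 : ∀ᶠ y in 𝓝 (0 : ℕ →ᵇ E), y ∈ e.source ∧ |π (y 0)| < δ / 2 := by
    refine (e.open_source.mem_nhds hsrc |> fun h => (h : ∀ᶠ y in 𝓝 0, y ∈ e.source)).and ?_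
    have hc : Continuous fun y : ℕ →ᵇ E => |π (y 0)| :=
      (π.comp (BoundedContinuousFunction.evalCLM ℝ (0 : ℕ))).continuous.abs
    exact hc.continuousAt.eventually_lt continuousAt_const (by simpa using hδ)
  obtain ⟨ε, hε, hsmall⟩ := Metric.eventually_nhds_iff.1 hev2
  refine ⟨δ, hδ, ε / 2, half_pos hε, fun t => e.symm (t, 0), hxcd, fun t ht n => ?_,
    fun t ht hz => ?_, fun y hy hyG => ?_⟩
  · have := congrArg (fun p : ℝ × (ℕ →ᵇ E) => p.2 n) (hΦx t ht)
    exact sub_eq_zero.1 this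
  · have hd : HasDerivAt (fun t : ℝ => e.symm (t, 0)) (deriv (fun t : ℝ => e.symm (t, 0)) t) t :=
      ((hxcd.contDiffAt (isOpen_Ioo.mem_nhds ht)).differentiableAt one_ne_zero).hasDerivAt
    have hd2 := (π.comp (BoundedContinuousFunction.evalCLM ℝ (0 : ℕ))).hasFDerivAt.comp_hasDerivAt
      t hd
    have hid : HasDerivAt (fun t : ℝ => t) 1 t := hasDerivAt_id t
    -- Since `π (x t 0) = t`, the derivative of `x t 0` has `π`-component 1 and cannot vanish.
    have heq : (fun t : ℝ => t) =ᶠ[𝓝 t]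
        (π.comp (BoundedContinuousFunction.evalCLM ℝ (0 : ℕ))) ∘ fun t : ℝ => e.symm (t, 0) := by
      filter_upwards [isOpen_Ioo.mem_nhds ht] with s hs
      exact (congrArg Prod.fst (hΦx s hs)).symm
    have := (hid.congr_of_eventuallyEq heq.symm).unique hd2
    change (1 : ℝ) = π (deriv (fun t : ℝ => e.symm (t, 0)) t 0) at this
    rw [hz, map_zero] at this
    exact one_ne_zero this
  -- A small backward orbit lies in the source of the local inverse and has image `(π (y 0), 0)`, so
  -- it is a point of the curve.
  · let Y : ℕ →ᵇ E := BoundedContinuousFunction.ofNormedAddCommGroupDiscrete y (ε / 2) hy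
    have hY : ‖Y‖ ≤ ε / 2 :=
      BoundedContinuousFunction.norm_ofNormedAddCommGroup_le _ (half_pos hε).le _
    obtain ⟨hYs, hYπ⟩ := hsmall (y := Y) (by rw [dist_zero_right]; linarith)
    have hΦY : Φ Y = (π (y 0), 0) := by
      refine Prod.ext rfl ?_
      ext n
      exact sub_eq_zero.2 (hyG n)
    refine ⟨π (y 0), abs_le.1 hYπ.le, fun n => ?_⟩
    change y n = e.symm (π (y 0), 0) n
    rw [← hΦY, ← hecoe, e.left_inv hYs]
    rfl

end LocalUnstable

/-! ### Eigenvalues at the fixed point. -/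

section Saddle

/-- A negative determinant makes the discriminant of the characteristic polynomial positive. -/
theorem exists_eigenvalues_of_det_neg (T : Plane →L[ℝ] Plane) (hdet : T.det < 0) :
    ∃ (b : Module.Basis (Fin 2) ℝ Plane) (μ ν : ℝ), T (b 0) = μ • b 0 ∧ T (b 1) = ν • b 1 ∧
      μ * ν = T.det := by
  set f : Module.End ℝ Plane := (T : Plane →ₗ[ℝ] Plane) with hf
  set b₀ := (EuclideanSpace.basisFun (Fin 2) ℝ).toBasis
  set M := LinearMap.toMatrix b₀ b₀ f with hM
  have hMdet : M.det = T.det := LinearMap.det_toMatrix b₀ f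
  have hchar : LinearMap.charpoly f =
      Polynomial.X ^ 2 - Polynomial.C M.trace * Polynomial.X + Polynomial.C M.det := by
    rw [← LinearMap.charpoly_toMatrix f b₀, Matrix.charpoly_fin_two]
  have hroot : ∀ μ : ℝ, μ ^ 2 - M.trace * μ + M.det = 0 → f.HasEigenvalue μ := fun μ h => by
    rw [Module.End.hasEigenvalue_iff_isRoot_charpoly, hchar]
    simpa using h
  have hdisc : 0 < M.trace ^ 2 - 4 * M.det := by nlinarith [sq_nonneg M.trace]
  set r := √(M.trace ^ 2 - 4 * M.det) with hr
  have hr0 : 0 < r := Real.sqrt_pos.2 hdisc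
  have hr2 : r ^ 2 = M.trace ^ 2 - 4 * M.det := Real.sq_sqrt hdisc.le
  obtain ⟨e, he⟩ := (hroot ((M.trace + r) / 2) (by nlinarith)).exists_hasEigenvector
  obtain ⟨e', he'⟩ := (hroot ((M.trace - r) / 2) (by nlinarith)).exists_hasEigenvector
  have hli : LinearIndependent ℝ ![e, e'] := by
    refine Module.End.eigenvectors_linearIndependent' f
      ![(M.trace + r) / 2, (M.trace - r) / 2] ?_ _ ?_
    · intro i j hij
      fin_cases i <;> fin_cases j <;> simp at hij ⊢ <;> linarith
    · intro i
      fin_cases i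
      · exact he
      · exact he'
  refine ⟨basisOfLinearIndependentOfCardEqFinrank hli (by simp), (M.trace + r) / 2,
    (M.trace - r) / 2, ?_, ?_, ?_⟩
  · simpa [hf] using he.apply_eq_smul
  · simpa [hf] using he'.apply_eq_smul
  · rw [← hMdet]
    nlinarith

/-- If neither eigenvalue exceeded 1 in modulus, the iterates of `u` would stay bounded. The product
has modulus below 1, so the other eigenvalue is contracting. -/
theorem exists_saddle_basis (T : Plane →L[ℝ] Plane) (hdet₁ : -1 < T.det) (hdet₂ : T.det < 0)
    {lam : ℝ} (hlam : 1 < lam) {u : Plane} (hu : u ≠ 0)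
    (hgrow : ∀ n : ℕ, lam ^ n * ‖u‖ ≤ ‖T^[n] u‖) :
    ∃ (b : Module.Basis (Fin 2) ℝ Plane) (μ ν : ℝ), T (b 0) = μ • b 0 ∧ T (b 1) = ν • b 1 ∧
      1 < |μ| ∧ |ν| < 1 := by
  obtain ⟨b, μ, ν, h0, h1, hprod⟩ := exists_eigenvalues_of_det_neg T hdet₂
  have habs : |μ| * |ν| < 1 := by
    rw [← abs_mul, hprod, abs_lt]
    constructor <;> linarith
  have hdec : u = b.repr u 0 • b 0 + b.repr u 1 • b 1 := by
    conv_lhs => rw [← b.sum_repr u, Fin.sum_univ_two]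
  have hiter : ∀ n : ℕ, T^[n] u =
      (μ ^ n * b.repr u 0) • b 0 + (ν ^ n * b.repr u 1) • b 1 := fun n => by
    induction n with
    | zero => simpa using hdec
    | succ n ih =>
      rw [Function.iterate_succ_apply', ih, map_add, map_smul, map_smul, h0, h1]
      simp only [smul_smul]
      congr 2 <;> ring
  have hbig : 1 < |μ| ∨ 1 < |ν| := by
    by_contra! hc
    have hb : ∀ n : ℕ, lam ^ n * ‖u‖ ≤ |b.repr u 0| * ‖b 0‖ + |b.repr u 1| * ‖b 1‖ := fun n => by
      refine (hgrow n).trans ?_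
      rw [hiter]
      refine (norm_add_le _ _).trans ?_
      simp only [norm_smul, norm_mul, norm_pow, Real.norm_eq_abs]
      have h2 := pow_le_one₀ (n := n) (abs_nonneg μ) hc.1
      have h3 := pow_le_one₀ (n := n) (abs_nonneg ν) hc.2
      gcongr
      · exact mul_le_of_le_one_left (abs_nonneg _) h2
      · exact mul_le_of_le_one_left (abs_nonneg _) h3
    have htend : Tendsto (fun n : ℕ => lam ^ n * ‖u‖) atTop atTop :=
      (tendsto_pow_atTop_atTop_of_one_lt hlam).atTop_mul_const (norm_pos_iff.2 hu)
    obtain ⟨n, hn⟩ := (htend.eventually_gt_atTop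
      (|b.repr u 0| * ‖b 0‖ + |b.repr u 1| * ‖b 1‖)).exists
    exact absurd (hb n) (not_le.2 hn)
  rcases hbig with h | h
  · exact ⟨b, μ, ν, h0, h1, h, by nlinarith [abs_nonneg ν]⟩
  · refine ⟨b.reindex (Equiv.swap 0 1), ν, μ, ?_, ?_, h, by nlinarith [abs_nonneg μ]⟩
    · simpa using h1
    · simpa using h0

end Saddle

/-! ### Geometry of a universal pair of cones. -/

section Cones

namespace Cone

theorem smul_mem_carrier (K : Cone) {u : Plane} (hu : u ∈ K.carrier) (c : ℝ) :
    c • u ∈ K.carrier := by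
  simp only [carrier, mem_ofPred_eq, norm_smul, inner_smul_left, abs_mul, Real.norm_eq_abs] at hu ⊢
  simp only [conj_trivial]
  nlinarith [abs_nonneg c, mul_le_mul_of_nonneg_left hu (abs_nonneg c)]

theorem isClosed_carrier (K : Cone) : IsClosed K.carrier :=
  isClosed_le (by fun_prop) (by fun_prop)

theorem dir_mem_carrier (K : Cone) : K.dir ∈ K.carrier := by
  simp [carrier, K.norm_dir, K.coeff_lt_one.le]

theorem dir_ne_zero (K : Cone) : K.dir ≠ 0 := by
  rw [← norm_ne_zero_iff, K.norm_dir]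
  exact one_ne_zero

theorem abs_inner_dir_of_axis_eq (K : Cone) {e : Plane} (he : ‖e‖ = 1)
    (h : K.axis = Submodule.span ℝ {e}) (u : Plane) : |inner ℝ u K.dir| = |inner ℝ u e| := by
  have hmem : K.dir ∈ Submodule.span ℝ {e} := h ▸ Submodule.mem_span_singleton_self _
  obtain ⟨c, hc⟩ := Submodule.mem_span_singleton.1 hmem
  have hc1 : |c| = 1 := by
    have := K.norm_dir
    rwa [← hc, norm_smul, he, mul_one, Real.norm_eq_abs] at this
  rw [← hc, inner_smul_right, abs_mul, hc1, one_mul]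

end Cone

theorem Plane.norm_sq (u : Plane) : ‖u‖ ^ 2 = u 0 ^ 2 + u 1 ^ 2 := by
  rw [EuclideanSpace.norm_sq_eq, Fin.sum_univ_two]
  simp

namespace IsUniversalPair

variable {Ku Ks : Cone} (h : IsUniversalPair Ku Ks)
include h

theorem mem_u_iff {u : Plane} : u ∈ Ku.carrier ↔ Ku.coeff * ‖u‖ ≤ |u 0| := by
  have : ‖(!₂[1, 0] : Plane)‖ = 1 := by simp [EuclideanSpace.norm_eq]
  change Ku.coeff * ‖u‖ ≤ |inner ℝ u Ku.dir| ↔ _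
  rw [Ku.abs_inner_dir_of_axis_eq this h.axis_u]
  simp [PiLp.inner_apply]

theorem mem_s_iff {u : Plane} : u ∈ Ks.carrier ↔ Ks.coeff * ‖u‖ ≤ |u 1| := by
  have : ‖(!₂[0, 1] : Plane)‖ = 1 := by simp [EuclideanSpace.norm_eq]
  change Ks.coeff * ‖u‖ ≤ |inner ℝ u Ks.dir| ↔ _
  rw [Ks.abs_inner_dir_of_axis_eq this h.axis_s]
  simp [PiLp.inner_apply]

theorem eq_zero {u : Plane} (hu : u ∈ Ku.carrier) (hs : u ∈ Ks.carrier) : u = 0 := by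
  have : u ∈ Ku.carrier ∩ Ks.carrier := ⟨hu, hs⟩
  rwa [h.disjoint] at this

/-- Otherwise a unit vector on the boundary of `Ku` would also lie in `Ks`. This turns disjointness
into a definite angle between the cones. -/
theorem one_lt_sq_add_sq : 1 < Ku.coeff ^ 2 + Ks.coeff ^ 2 := by
  by_contra! hc
  have hn : 0 ≤ 1 - Ku.coeff ^ 2 := by nlinarith [sq_nonneg Ks.coeff]
  set w : Plane := !₂[Ku.coeff, √(1 - Ku.coeff ^ 2)] with hw
  have hnorm : ‖w‖ = 1 := by
    have := Plane.norm_sq w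
    simp only [hw, Matrix.cons_val_zero, Matrix.cons_val_one, Real.sq_sqrt hn] at this
    rw [← sq_eq_sq₀ (norm_nonneg _) zero_le_one, this]
    ring
  have h1 : w ∈ Ku.carrier := by
    rw [h.mem_u_iff, hnorm, mul_one]
    exact le_abs_self _
  have h2 : w ∈ Ks.carrier := by
    rw [h.mem_s_iff, hnorm, mul_one]
    refine le_trans ?_ (le_abs_self _)
    exact Real.le_sqrt_of_sq_le (by linarith)
  have := h.eq_zero h1 h2
  rw [this, norm_zero] at hnorm
  exact zero_ne_one hnorm

/-- Decomposition of vectors along an unstable and a stable direction, with a uniform bound on the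
stable component. -/
theorem exists_decomposition : ∃ C, ∀ u ∈ Ku.carrier, u ≠ 0 → ∀ w ∈ Ks.carrier, w ≠ 0 →
    ∀ v : Plane, ∃ a b : ℝ, v = a • u + b • w ∧ |b| * ‖w‖ ≤ C * ‖v‖ := by
  have hsum := h.one_lt_sq_add_sq
  set k := Ku.coeff with hk
  set l := Ks.coeff with hl
  have hk0 : 0 < k := Ku.coeff_pos
  have hl0 : 0 < l := Ks.coeff_pos
  have hk1 : k < 1 := Ku.coeff_lt_one
  have hl1 : l < 1 := Ks.coeff_lt_one
  have hkk : 0 < 1 - k ^ 2 := by nlinarith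
  have hll : 0 < 1 - l ^ 2 := by nlinarith
  -- A lower bound for the determinant of a unit unstable and a unit stable vector; it is positive
  -- because `k² + l² > 1`.
  set d := k * l - √((1 - k ^ 2) * (1 - l ^ 2)) with hd
  have hdpos : 0 < d := by
    rw [hd, sub_pos, Real.sqrt_lt' (by positivity)]
    nlinarith
  refine ⟨2 / d, fun u hu hu0 w hw hw0 v => ?_⟩
  have hun : 0 < ‖u‖ := norm_pos_iff.2 hu0
  have hwn : 0 < ‖w‖ := norm_pos_iff.2 hw0
  rw [h.mem_u_iff] at hu
  rw [h.mem_s_iff] at hw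
  have hus := Plane.norm_sq u
  have hws := Plane.norm_sq w
  have hvs := Plane.norm_sq v
  have hcoord : ∀ (z : Plane) (i : Fin 2), |z i| ≤ ‖z‖ := fun z i => PiLp.norm_apply_le z i
  have hu1 : u 1 ^ 2 ≤ (1 - k ^ 2) * ‖u‖ ^ 2 := by
    have : (k * ‖u‖) ^ 2 ≤ u 0 ^ 2 := by
      rw [← sq_abs (u 0)]
      gcongr
    nlinarith
  have hw1 : w 0 ^ 2 ≤ (1 - l ^ 2) * ‖w‖ ^ 2 := by
    have : (l * ‖w‖) ^ 2 ≤ w 1 ^ 2 := by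
      rw [← sq_abs (w 1)]
      gcongr
    nlinarith
  set Δ := u 0 * w 1 - u 1 * w 0 with hΔ
  have hΔd : d * (‖u‖ * ‖w‖) ≤ |Δ| := by
    have h1 : k * l * (‖u‖ * ‖w‖) ≤ |u 0 * w 1| := by
      rw [abs_mul]
      calc k * l * (‖u‖ * ‖w‖) = (k * ‖u‖) * (l * ‖w‖) := by ring
        _ ≤ _ := by gcongr
    have h2 : |u 1 * w 0| ≤ √((1 - k ^ 2) * (1 - l ^ 2)) * (‖u‖ * ‖w‖) := by
      refine abs_le_of_sq_le_sq ?_ (by positivity)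
      rw [mul_pow, mul_pow, Real.sq_sqrt (by positivity), mul_pow]
      calc u 1 ^ 2 * w 0 ^ 2 ≤ ((1 - k ^ 2) * ‖u‖ ^ 2) * ((1 - l ^ 2) * ‖w‖ ^ 2) := by gcongr
        _ = _ := by ring
    have h3 := abs_sub_abs_le_abs_sub (u 0 * w 1) (u 1 * w 0)
    rw [hd]
    nlinarith
  have hΔ0 : Δ ≠ 0 := by
    rw [← abs_pos]
    exact lt_of_lt_of_le (by positivity) hΔd
  -- Cramer's rule.
  refine ⟨(v 0 * w 1 - v 1 * w 0) / Δ, (u 0 * v 1 - u 1 * v 0) / Δ, ?_, ?_⟩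
  · ext i
    fin_cases i
    · simp only [Fin.zero_eta, PiLp.add_apply, PiLp.smul_apply, smul_eq_mul]
      field_simp
      rw [hΔ]; ring
    · simp only [Fin.mk_one, PiLp.add_apply, PiLp.smul_apply, smul_eq_mul]
      field_simp
      rw [hΔ]; ring
  · rw [abs_div, div_mul_eq_mul_div, div_le_iff₀ (abs_pos.2 hΔ0)]
    have h1 : |u 0 * v 1 - u 1 * v 0| ≤ 2 * (‖u‖ * ‖v‖) := by
      refine (abs_sub _ _).trans ?_
      rw [abs_mul, abs_mul]
      have := mul_le_mul (hcoord u 0) (hcoord v 1) (abs_nonneg _) (norm_nonneg _)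
      have := mul_le_mul (hcoord u 1) (hcoord v 0) (abs_nonneg _) (norm_nonneg _)
      linarith
    calc |u 0 * v 1 - u 1 * v 0| * ‖w‖ ≤ 2 * (‖u‖ * ‖v‖) * ‖w‖ := by gcongr
      _ = 2 / d * ‖v‖ * (d * (‖u‖ * ‖w‖)) := by field_simp
      _ ≤ 2 / d * ‖v‖ * |Δ| := by gcongr

end IsUniversalPair

end Cones

/-! ### Tangent vectors and unstable curves of one hyperbolic diffeomorphism. -/

section Hyperbolic

namespace PlaneDiffeo

variable (F : PlaneDiffeo)

theorem differentiable : Differentiable ℝ F := F.contDiff.differentiable one_ne_zero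

theorem fderiv_symm_apply_fderiv (P v : Plane) :
    fderiv ℝ F.symm (F P) (fderiv ℝ F P v) = v := by
  have h := (PlaneDiffeo.differentiable F.symm (F P)).hasFDerivAt.comp P (PlaneDiffeo.differentiable F P).hasFDerivAt
  have hid : (F.symm : Plane → Plane) ∘ F = id := by
    funext x
    exact F.symm_apply_apply x
  rw [hid] at h
  have := h.unique (hasFDerivAt_id P)
  exact congrArg (fun f : Plane →L[ℝ] Plane => f v) this

theorem fderiv_apply_fderiv_symm (P v : Plane) :
    fderiv ℝ F P (fderiv ℝ F.symm (F P) v) = v := by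
  have := PlaneDiffeo.fderiv_symm_apply_fderiv F.symm (F P) v
  rwa [show F.symm (F P) = P from F.symm_apply_apply P] at this

end PlaneDiffeo

/-- A bounded backward orbit of tangent vectors along a backward orbit lies in the unstable
cones. -/
theorem IsConeHyperbolic.mem_of_bounded_backward {F : PlaneDiffeo} {lam : ℝ} {Cu Cs : ConeField}
    (hF : IsConeHyperbolic F lam Cu Cs) (hlam : 1 < lam) {Ku Ks : Cone}
    (hK : IsUniversalPair Ku Ks) (hCu : ∀ P, (Cu.cone P).carrier ⊆ Ku.carrier)
    (hCs : ∀ P, (Cs.cone P).carrier ⊆ Ks.carrier) {x v : ℕ → Plane}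
    (hx : ∀ n, F (x (n + 1)) = x n) (hv : ∀ n, fderiv ℝ F (x (n + 1)) (v (n + 1)) = v n)
    {B : ℝ} (hB : ∀ n, ‖v n‖ ≤ B) : v 0 ∈ (Cu.cone (x 0)).carrier := by
  obtain ⟨C, hC⟩ := hK.exists_decomposition
  -- A stable vector `w` at `x 0` is pulled back to `w'` at `x N`, growing by `lam ^ N`. Pushing a
  -- decomposition of `v N` forward leaves the coefficient `b` unchanged; as `v` is bounded, `b` is
  -- `O(lam⁻ᴺ)`, so `v 0` is a limit of vectors of the closed unstable cone.
  have hstep : ∀ N, ∀ u ∈ (Cu.cone (x N)).carrier, ∀ w ∈ (Cs.cone (x 0)).carrier, ∃ w' ∈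
      (Cs.cone (x N)).carrier, lam ^ N * ‖w‖ ≤ ‖w'‖ ∧ ∀ a b : ℝ, v N = a • u + b • w' →
        ∃ u' ∈ (Cu.cone (x 0)).carrier, v 0 = u' + b • w := by
    intro N
    induction N with
    | zero =>
      intro u hu w hw
      exact ⟨w, hw, by simp, fun a b h => ⟨a • u, Cone.smul_mem_carrier _ hu a, h⟩⟩
    | succ N ih =>
      intro u hu w hw
      have hu' : fderiv ℝ F (x (N + 1)) u ∈ (Cu.cone (x N)).carrier := by
        have := hF.map_u _ u hu
        rwa [hx] at this
      obtain ⟨w', hw', hgrow, hdec⟩ := ih _ hu' w hw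
      have hsymm : F.symm (x N) = x (N + 1) := by
        rw [← hx N]
        exact F.symm_apply_apply _
      have hDD : fderiv ℝ F (x (N + 1)) (fderiv ℝ F.symm (x N) w') = w' := by
        have := PlaneDiffeo.fderiv_apply_fderiv_symm F (x (N + 1)) w'
        rwa [hx] at this
      refine ⟨fderiv ℝ F.symm (x N) w', ?_, ?_, fun a b h => hdec a b ?_⟩
      · have := hF.map_s _ w' hw'
        rwa [hsymm] at this
      · have := hF.stretch_s _ w' hw'
        rw [pow_succ]
        nlinarith
      · rw [← hv N, h, map_add, map_smul, map_smul, hDD]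
  set w := (Cs.cone (x 0)).dir with hwdef
  have hwn : ‖w‖ = 1 := (Cs.cone (x 0)).norm_dir
  have happrox : ∀ N : ℕ, ∃ u' ∈ (Cu.cone (x 0)).carrier,
      ‖v 0 - u'‖ ≤ |C| * B * (lam⁻¹) ^ N := fun N => by
    set u := (Cu.cone (x N)).dir
    have hu : u ∈ (Cu.cone (x N)).carrier := Cone.dir_mem_carrier _
    obtain ⟨w', hw', hgrow, hdec⟩ := hstep N u hu w (Cone.dir_mem_carrier _)
    rw [hwn, mul_one] at hgrow
    have hpow : 0 < lam ^ N := by positivity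
    have hw'0 : w' ≠ 0 := norm_pos_iff.1 (hpow.trans_le hgrow)
    obtain ⟨a, b, hab, hb⟩ := hC u (hCu _ hu) (Cone.dir_ne_zero _) w' (hCs _ hw') hw'0 (v N)
    obtain ⟨u', hu', h0⟩ := hdec a b hab
    refine ⟨u', hu', ?_⟩
    rw [h0, add_sub_cancel_left, norm_smul, hwn, mul_one, Real.norm_eq_abs, inv_pow,
      ← div_eq_mul_inv, le_div_iff₀ hpow]
    calc |b| * lam ^ N ≤ |b| * ‖w'‖ := by gcongr
      _ ≤ C * ‖v N‖ := hb
      _ ≤ |C| * ‖v N‖ := by gcongr; exact le_abs_self C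
      _ ≤ |C| * B := by gcongr; exact hB N
  choose u' hu' hlim using happrox
  refine (Cone.isClosed_carrier _).mem_of_tendsto (f := u') (b := atTop) ?_ (.of_forall hu')
  have hz : Tendsto (fun N : ℕ => |C| * B * (lam⁻¹) ^ N) atTop (𝓝 (|C| * B * 0)) :=
    (tendsto_pow_atTop_nhds_zero_of_lt_one (by positivity)
      (inv_lt_one_of_one_lt₀ hlam)).const_mul _
  rw [mul_zero] at hz
  refine tendsto_iff_norm_sub_tendsto_zero.2 (squeeze_zero (fun _ => norm_nonneg _) (fun N => ?_) hz)
  rw [norm_sub_rev]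
  exact hlim N

theorem IsConeHyperbolic.pow_mul_norm_le_iterate {F : PlaneDiffeo} {lam : ℝ} {Cu Cs : ConeField}
    (hF : IsConeHyperbolic F lam Cu Cs) (hlam : 1 < lam) {X : Plane} (hX : F X = X) {u : Plane}
    (hu : u ∈ (Cu.cone X).carrier) (n : ℕ) :
    (fderiv ℝ F X)^[n] u ∈ (Cu.cone X).carrier ∧ lam ^ n * ‖u‖ ≤ ‖(fderiv ℝ F X)^[n] u‖ := by
  induction n with
  | zero => simpa using hu
  | succ n ih =>
    rw [Function.iterate_succ_apply']
    have h1 := hF.map_u X _ ih.1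
    rw [hX] at h1
    refine ⟨h1, ?_⟩
    have h2 := hF.stretch_u X _ ih.1
    rw [pow_succ]
    nlinarith [ih.2]

/-- A fixed point of a hyperbolic orientation reversing area contracting diffeomorphism has a local
unstable curve, tangent to the unstable cones, which contains every backward orbit that stays near
the fixed point. -/
theorem IsConeHyperbolic.exists_local_unstable_curve {F : PlaneDiffeo} {lam : ℝ} {Cu Cs : ConeField}
    (hF : IsConeHyperbolic F lam Cu Cs) (hlam : 1 < lam) {Ku Ks : Cone}
    (hK : IsUniversalPair Ku Ks) (hCu : ∀ P, (Cu.cone P).carrier ⊆ Ku.carrier)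
    (hCs : ∀ P, (Cs.cone P).carrier ⊆ Ks.carrier) {X : Plane} (hX : F X = X)
    (hdet : -1 < (fderiv ℝ F X).det ∧ (fderiv ℝ F X).det < 0) :
    ∃ δ > 0, ∃ ε > 0, ∃ γ γ' : ℝ → Plane, ContinuousOn γ' (Icc (-δ) δ) ∧
      (∀ t ∈ Icc (-δ) δ, HasDerivAt γ (γ' t) t ∧ γ' t ∈ (Cu.cone (γ t)).carrier ∧ γ' t ≠ 0) ∧
      ∀ q : ℕ → Plane, (∀ n, ‖q n - X‖ ≤ ε) → (∀ n, F (q (n + 1)) = q n) →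
        q 0 ∈ γ '' Icc (-δ) δ := by
  set G : Plane → Plane := fun z => F (X + z) - X with hGdef
  have hG : ContDiff ℝ 1 G :=
    (F.contDiff.comp (contDiff_const.add contDiff_id)).sub contDiff_const
  have hG0 : G 0 = 0 := by simp [hGdef, hX]
  have hGd : ∀ z, fderiv ℝ G z = fderiv ℝ F (X + z) := fun z => by
    simp only [hGdef]
    rw [fderiv_sub_const, fderiv_comp_add_left]
  obtain ⟨b, μ, ν, h0, h1, hμ, hν⟩ := exists_saddle_basis (fderiv ℝ F X) hdet.1 hdet.2 hlam
    (Cone.dir_ne_zero (Cu.cone X)) fun n =>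
      (hF.pow_mul_norm_le_iterate hlam hX (Cone.dir_mem_carrier _) n).2
  obtain ⟨δ, hδ, ε, hε, x, hxcd, hxorb, hxne, huniq⟩ := _root_.exists_local_unstable_curve hG hG0 b
    (by rw [hGd, add_zero, h0]) (by rw [hGd, add_zero, h1]) hμ hν
  have hsub : Icc (-(δ / 2)) (δ / 2) ⊆ Ioo (-δ) δ := fun t ht =>
    ⟨by linarith [ht.1], by linarith [ht.2]⟩
  have hev : ∀ n : ℕ, ∀ t ∈ Ioo (-δ) δ, HasDerivAt (fun s => x s n) (deriv x t n) t :=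
    fun n t ht => (BoundedContinuousFunction.evalCLM (β := Plane) ℝ n).hasFDerivAt.comp_hasDerivAt t
      ((hxcd.contDiffAt (isOpen_Ioo.mem_nhds ht)).differentiableAt one_ne_zero).hasDerivAt
  refine ⟨δ / 2, half_pos hδ, ε, hε, fun t => X + x t 0, fun t => deriv x t 0, ?_,
    fun t ht => ⟨(hev 0 t (hsub ht)).const_add X, ?_, hxne t (hsub ht)⟩, fun q hq hqF => ?_⟩
  · exact (BoundedContinuousFunction.evalCLM ℝ (0 : ℕ)).continuous.comp_continuousOn
      ((hxcd.continuousOn_deriv_of_isOpen isOpen_Ioo le_rfl).mono hsub)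
  · have ht' := hsub ht
    -- The derivative in `t` of the orbits is a bounded backward orbit of tangent vectors.
    refine hF.mem_of_bounded_backward hlam hK hCu hCs (x := fun n => X + x t n)
      (v := fun n => deriv x t n) (fun n => ?_) (fun n => ?_)
      (fun n => (deriv x t).norm_coe_le_norm n)
    · have := hxorb t ht' n
      rw [← this]
      simp [hGdef]
    · have hd := (hG.differentiable one_ne_zero (x t (n + 1))).hasFDerivAt.comp_hasDerivAt t
        (hev (n + 1) t ht')
      rw [hGd] at hd
      refine (hd.congr_of_eventuallyEq ?_).unique (hev n t ht')
      filter_upwards [isOpen_Ioo.mem_nhds ht'] with s hs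
      exact (hxorb s hs n).symm
  · obtain ⟨t, ht, hy⟩ := huniq (fun n => q n - X) hq (fun n => by simp [hGdef, hqF])
    refine ⟨t, ht, ?_⟩
    change X + x t 0 = q 0
    rw [← hy 0]
    simp

end Hyperbolic

/-! ### Curves tangent to the unstable cones. -/

section Curves

theorem HasDerivAt.plane_apply {γ : ℝ → Plane} {v : Plane} {t : ℝ} (h : HasDerivAt γ v t)
    (i : Fin 2) : HasDerivAt (fun s => γ s i) (v i) t :=
  (PiLp.hasFDerivAt_apply (𝕜 := ℝ) 2 (γ t) i).comp_hasDerivAt t h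

/-- `γ` is, on `[a, b]`, a `C¹` curve of speed at least `c > 0` with velocity `γ'` in the cones. -/
structure IsConeCurve (C : ConeField) (γ γ' : ℝ → Plane) (a b c : ℝ) : Prop where
  le : a ≤ b
  pos : 0 < c
  continuousOn_deriv : ContinuousOn γ' (Icc a b)
  hasDerivAt : ∀ t ∈ Icc a b, HasDerivAt γ (γ' t) t
  mem : ∀ t ∈ Icc a b, γ' t ∈ (C.cone (γ t)).carrier
  speed : ∀ t ∈ Icc a b, c ≤ ‖γ' t‖

namespace IsConeCurve

variable {C : ConeField} {γ γ' : ℝ → Plane} {a b c : ℝ}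

theorem mono (h : IsConeCurve C γ γ' a b c) {a' b' : ℝ} (ha : a ≤ a') (hab : a' ≤ b')
    (hb : b' ≤ b) : IsConeCurve C γ γ' a' b' c := by
  have hs : Icc a' b' ⊆ Icc a b := Icc_subset_Icc ha hb
  exact ⟨hab, h.pos, h.continuousOn_deriv.mono hs, fun t ht => h.hasDerivAt t (hs ht),
    fun t ht => h.mem t (hs ht), fun t ht => h.speed t (hs ht)⟩

theorem continuousOn (h : IsConeCurve C γ γ' a b c) : ContinuousOn γ (Icc a b) := fun t ht =>
  (h.hasDerivAt t ht).continuousAt.continuousWithinAt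

theorem ne_zero (h : IsConeCurve C γ γ' a b c) {t : ℝ} (ht : t ∈ Icc a b) : γ' t ≠ 0 :=
  norm_pos_iff.1 (h.pos.trans_le (h.speed t ht))

theorem comp (h : IsConeCurve C γ γ' a b c) {F : PlaneDiffeo} {lam : ℝ} {Cs : ConeField}
    (hF : IsConeHyperbolic F lam C Cs) (hlam : 0 < lam) :
    IsConeCurve C (fun t => F (γ t)) (fun t => fderiv ℝ F (γ t) (γ' t)) a b (lam * c) where
  le := h.le
  pos := mul_pos hlam h.pos
  continuousOn_deriv := ((F.contDiff.continuous_fderiv one_ne_zero).comp_continuousOn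
    h.continuousOn).clm_apply h.continuousOn_deriv
  hasDerivAt t ht :=
    (PlaneDiffeo.differentiable F (γ t)).hasFDerivAt.comp_hasDerivAt t (h.hasDerivAt t ht)
  mem t ht := hF.map_u _ _ (h.mem t ht)
  speed t ht := by
    have h1 := hF.stretch_u _ _ (h.mem t ht)
    have h2 := mul_le_mul_of_nonneg_left (h.speed t ht) hlam.le
    linarith

variable {Ku Ks : Cone}

/-- By Rolle, a repeated first coordinate would give a vertical velocity, which `Ku` excludes. -/
theorem injOn_fst (h : IsConeCurve C γ γ' a b c) (hK : IsUniversalPair Ku Ks)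
    (hC : ∀ P, (C.cone P).carrier ⊆ Ku.carrier) : InjOn (fun t => γ t 0) (Icc a b) := by
  have key : ∀ s ∈ Icc a b, ∀ t ∈ Icc a b, s < t → γ s 0 ≠ γ t 0 := by
    intro s hs t ht hst heq
    have hsub : Icc s t ⊆ Icc a b := Icc_subset_Icc hs.1 ht.2
    obtain ⟨r, hr, hr0⟩ := exists_hasDerivAt_eq_zero (f := fun t => γ t 0)
      (f' := fun t => γ' t 0) hst
      (fun r hr => ((h.hasDerivAt r (hsub hr)).plane_apply 0).continuousAt.continuousWithinAt) heq
      (fun r hr => (h.hasDerivAt r (hsub (Ioo_subset_Icc_self hr))).plane_apply 0)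
    have hr' := hsub (Ioo_subset_Icc_self hr)
    have hm := hK.mem_u_iff.1 (hC _ (h.mem r hr'))
    rw [hr0, abs_zero] at hm
    have := mul_pos Ku.coeff_pos (norm_pos_iff.2 (h.ne_zero hr'))
    linarith
  intro s hs t ht hst
  rcases lt_trichotomy s t with hlt | heq | hlt
  · exact absurd hst (key s hs t ht hlt)
  · exact heq
  · exact absurd hst.symm (key t ht s hs hlt)

/-- By the mean value theorem; in a bounded region this limits `c * (b - a)`, the quantity that
stands for length throughout. -/
theorem mul_le_abs_sub_fst (h : IsConeCurve C γ γ' a b c) (hK : IsUniversalPair Ku Ks)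
    (hC : ∀ P, (C.cone P).carrier ⊆ Ku.carrier) (hab : a < b) :
    Ku.coeff * (c * (b - a)) ≤ |γ b 0 - γ a 0| := by
  obtain ⟨r, hr, hr0⟩ := exists_hasDerivAt_eq_slope (f := fun t => γ t 0)
    (f' := fun t => γ' t 0) hab
    (fun r hr => ((h.hasDerivAt r hr).plane_apply 0).continuousAt.continuousWithinAt)
    (fun r hr => (h.hasDerivAt r (Ioo_subset_Icc_self hr)).plane_apply 0)
  have hr' := Ioo_subset_Icc_self hr
  have hba : 0 < b - a := sub_pos.2 hab
  have hm := hK.mem_u_iff.1 (hC _ (h.mem r hr'))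
  rw [hr0, abs_div, abs_of_pos hba, le_div_iff₀ hba] at hm
  refine le_trans ?_ hm
  have := h.speed r hr'
  have hk := Ku.coeff_pos
  rw [← mul_assoc]
  gcongr

theorem isSmoothArc (h : IsConeCurve C γ γ' a b c) (hK : IsUniversalPair Ku Ks)
    (hC : ∀ P, (C.cone P).carrier ⊆ Ku.carrier) (hab : a < b) : IsSmoothArc (γ '' Icc a b) := by
  have hba : 0 < b - a := sub_pos.2 hab
  have himg : (fun s : ℝ => (b - a) * s + a) '' Icc 0 1 = Icc a b := by
    rw [image_affine_Icc' hba]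
    simp
  have hmaps : ∀ s ∈ Icc (0 : ℝ) 1, (b - a) * s + a ∈ Icc a b := fun s hs =>
    himg ▸ mem_image_of_mem _ hs
  have hder : ∀ s ∈ Icc (0 : ℝ) 1, HasDerivAt (fun s => γ ((b - a) * s + a))
      ((b - a) • γ' ((b - a) * s + a)) s := fun s hs => by
    refine HasDerivAt.scomp s (h.hasDerivAt _ (hmaps s hs)) ?_
    simpa using ((hasDerivAt_id s).const_mul (b - a)).add_const a
  have hu : UniqueDiffOn ℝ (Icc (0 : ℝ) 1) := uniqueDiffOn_Icc_zero_one
  have hdw : ∀ s ∈ Icc (0 : ℝ) 1, derivWithin (fun s => γ ((b - a) * s + a)) (Icc 0 1) s =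
      (b - a) • γ' ((b - a) * s + a) := fun s hs =>
    (hder s hs).hasDerivWithinAt.derivWithin (hu s hs)
  refine ⟨fun s => γ ((b - a) * s + a), ?_, ?_, fun s hs => ?_, ?_⟩
  · rw [contDiffOn_one_iff_derivWithin hu]
    refine ⟨fun s hs => (hder s hs).differentiableAt.differentiableWithinAt, ?_⟩
    refine ContinuousOn.congr ?_ hdw
    exact (h.continuousOn_deriv.comp (by fun_prop) hmaps).const_smul (b - a)
  · intro s hs t ht hst
    have := h.injOn_fst hK hC (hmaps s hs) (hmaps t ht) (congrArg (fun P : Plane => P 0) hst)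
    simpa [hba.ne'] using this
  · rw [hdw s hs]
    exact smul_ne_zero hba.ne' (h.ne_zero (hmaps s hs))
  · rw [← himg, image_image]

end IsConeCurve

end Curves

/-! ### Unstable curves and the divider. -/

namespace SynchronouslyHyperbolic

variable (S : SynchronouslyHyperbolic)

theorem lam_pos : 0 < S.lam := one_pos.trans S.one_lt_lam

theorem eq_of_mem_divider {P : Plane} (hP : P ∈ S.divider) : P = !₂[S.g (P 1), P 1] := by
  ext i
  fin_cases i
  · exact hP
  · rfl

theorem F₁_eq_F₂ {P : Plane} (hP : P ∈ S.divider) : S.F₁ P = S.F₂ P := by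
  rw [S.eq_of_mem_divider hP]
  exact S.agree _

theorem map_of_mem_left {P : Plane} (hP : P ∈ S.leftHalfPlane) : S.map P = S.F₁ P := if_pos hP

theorem map_of_mem_right {P : Plane} (hP : P ∈ S.rightHalfPlane) : S.map P = S.F₂ P := by
  by_cases h : P ∈ S.leftHalfPlane
  · rw [S.map_of_mem_left h]
    exact S.F₁_eq_F₂ (le_antisymm h hP)
  · exact if_neg h

/-- The curve `γ` stays on one side of the divider on `[a, b]`. -/
def OneSided (γ : ℝ → Plane) (a b : ℝ) : Prop :=
  (∀ t ∈ Icc a b, γ t ∈ S.leftHalfPlane) ∨ ∀ t ∈ Icc a b, γ t ∈ S.rightHalfPlane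

variable {S} {γ γ' : ℝ → Plane} {a b c : ℝ}

theorem OneSided.exists_image (hs : S.OneSided γ a b) (h : IsConeCurve S.Cu γ γ' a b c) :
    ∃ δ δ' : ℝ → Plane, IsConeCurve S.Cu δ δ' a b (S.lam * c) ∧
      ∀ t ∈ Icc a b, δ t = S.map (γ t) := by
  rcases hs with hs | hs
  · exact ⟨_, _, h.comp S.hyp₁ S.lam_pos, fun t ht => (S.map_of_mem_left (hs t ht)).symm⟩
  · exact ⟨_, _, h.comp S.hyp₂ S.lam_pos, fun t ht => (S.map_of_mem_right (hs t ht)).symm⟩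

/-- The signed horizontal distance to the divider is injective along unstable curves. -/
theorem injOn_sub_divider (h : IsConeCurve S.Cu γ γ' a b c) :
    InjOn (fun t => γ t 0 - S.g (γ t 1)) (Icc a b) := by
  have hder : ∀ t ∈ Icc a b, HasDerivAt (fun t => γ t 0 - S.g (γ t 1))
      (γ' t 0 - deriv S.g (γ t 1) * γ' t 1) t := fun t ht => by
    have h0 := (h.hasDerivAt t ht).plane_apply 0
    have h1 := (h.hasDerivAt t ht).plane_apply 1
    exact h0.sub ((S.g_smooth.differentiable one_ne_zero (γ t 1)).hasDerivAt.comp t h1)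
  have key : ∀ s ∈ Icc a b, ∀ t ∈ Icc a b, s < t →
      γ s 0 - S.g (γ s 1) ≠ γ t 0 - S.g (γ t 1) := by
    intro s hs t ht hst heq
    have hsub : Icc s t ⊆ Icc a b := Icc_subset_Icc hs.1 ht.2
    obtain ⟨r, hr, hr0⟩ := exists_hasDerivAt_eq_zero hst
      (fun r hr => (hder r (hsub hr)).continuousAt.continuousWithinAt) heq
      (fun r hr => hder r (hsub (Ioo_subset_Icc_self hr)))
    have hr' := hsub (Ioo_subset_Icc_self hr)
    refine h.ne_zero hr' (S.universal.eq_zero (S.Cu_subset _ (h.mem r hr')) ?_)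
    -- The velocity is parallel to the tangent of the divider at the height of `γ r`. The point `γ
    -- r` itself may be off the divider, hence the comparison in the universal cones.
    have hvec : γ' r = γ' r 1 • (!₂[deriv S.g (γ r 1), 1] : Plane) := by
      ext i
      fin_cases i
      · simp
        linarith
      · simp
    rw [hvec]
    exact Cone.smul_mem_carrier _ (S.Cs_subset _ (S.tangent_s _)) _
  intro s hs t ht hst
  rcases lt_trichotomy s t with hlt | heq | hlt
  · exact absurd hst (key s hs t ht hlt)
  · exact heq
  · exact absurd hst.symm (key t ht s hs hlt)

theorem continuousOn_sub_divider (h : IsConeCurve S.Cu γ γ' a b c) :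
    ContinuousOn (fun t => γ t 0 - S.g (γ t 1)) (Icc a b) := by
  have := h.continuousOn
  have hg := S.g_smooth.continuous
  have h0 : ContinuousOn (fun t => γ t 0) (Icc a b) := by fun_prop
  have h1 : ContinuousOn (fun t => γ t 1) (Icc a b) := by fun_prop
  exact h0.sub (hg.comp_continuousOn h1)

theorem oneSided_of_notMem (h : IsConeCurve S.Cu γ γ' a b c)
    (hno : ∀ t ∈ Icc a b, γ t ∉ S.divider) : S.OneSided γ a b := by
  have hc := continuousOn_sub_divider h
  by_contra! hcon
  simp only [OneSided, not_or, not_forall, exists_prop] at hcon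
  obtain ⟨⟨s, hs, hs'⟩, t, ht, ht'⟩ := hcon
  have hs0 : S.g (γ s 1) < γ s 0 := not_le.1 hs'
  have ht0 : γ t 0 < S.g (γ t 1) := not_le.1 ht'
  have hsub : uIcc t s ⊆ Icc a b := ordConnected_Icc.uIcc_subset ht hs
  obtain ⟨r, hr, hr0⟩ := intermediate_value_uIcc (hc.mono hsub)
    (mem_uIcc_of_le (show γ t 0 - S.g (γ t 1) ≤ 0 by linarith)
      (show 0 ≤ γ s 0 - S.g (γ s 1) by linarith))
  exact hno r (hsub hr) (sub_eq_zero.1 hr0)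

/-- An unstable curve crosses the divider at most once. -/
theorem oneSided_or_exists_split (h : IsConeCurve S.Cu γ γ' a b c) :
    S.OneSided γ a b ∨ ∃ t ∈ Icc a b, γ t ∈ S.divider ∧ S.OneSided γ a t ∧ S.OneSided γ t b := by
  by_cases hno : ∀ t ∈ Icc a b, γ t ∉ S.divider
  · exact Or.inl (oneSided_of_notMem h hno)
  push Not at hno
  obtain ⟨t, ht, hdiv⟩ := hno
  refine Or.inr ⟨t, ht, hdiv, ?_⟩
  have ht0 : γ t 0 - S.g (γ t 1) = 0 := sub_eq_zero.2 hdiv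
  have hleft : ∀ s ∈ Icc a t, s ∈ Icc a b := fun s hs => ⟨hs.1, hs.2.trans ht.2⟩
  have hright : ∀ s ∈ Icc t b, s ∈ Icc a b := fun s hs => ⟨ht.1.trans hs.1, hs.2⟩
  rcases (continuousOn_sub_divider h).strictMonoOn_of_injOn_Icc' h.le (injOn_sub_divider h) with
    hm | hm
  · refine ⟨Or.inl fun s hs => ?_, Or.inr fun s hs => ?_⟩
    · have := hm.monotoneOn (hleft s hs) ht hs.2
      simp only [ht0] at this
      exact sub_nonpos.1 this
    · have := hm.monotoneOn ht (hright s hs) hs.1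
      simp only [ht0] at this
      exact sub_nonneg.1 this
  · refine ⟨Or.inr fun s hs => ?_, Or.inl fun s hs => ?_⟩
    · have := hm.antitoneOn (hleft s hs) ht hs.2
      simp only [ht0] at this
      exact sub_nonneg.1 this
    · have := hm.antitoneOn ht (hright s hs) hs.1
      simp only [ht0] at this
      exact sub_nonpos.1 this

variable (S) in
/-- The set `C` is the trace of an unstable curve. -/
def IsConeCurveTrace (C : Set Plane) : Prop :=
  ∃ γ γ' a b c, IsConeCurve S.Cu γ γ' a b c ∧ γ '' Icc a b = C

/-- Each step cuts a curve at most once, at the divider, and maps each piece to an unstable curve.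
-/
theorem exists_finite_cover {C : Set Plane} (hC : S.IsConeCurveTrace C) (N : ℕ) :
    ∃ 𝒞 : Set (Set Plane), 𝒞.Finite ∧ (∀ B ∈ 𝒞, S.IsConeCurveTrace B) ∧
      S.map^[N] '' C ⊆ ⋃₀ 𝒞 := by
  induction N generalizing C with
  | zero => exact ⟨{C}, finite_singleton C, by simpa using hC, by simp⟩
  | succ N ih =>
    have hone : ∀ {γ γ' : ℝ → Plane} {a b c : ℝ}, IsConeCurve S.Cu γ γ' a b c →
        S.OneSided γ a b → S.IsConeCurveTrace (S.map '' (γ '' Icc a b)) := by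
      intro γ γ' a b c h hs
      obtain ⟨δ, δ', hδ, heq⟩ := hs.exists_image h
      exact ⟨δ, δ', a, b, _, hδ, by rw [image_image]; exact image_congr heq⟩
    have hstep : ∃ B B', S.IsConeCurveTrace B ∧ S.IsConeCurveTrace B' ∧
        S.map '' C ⊆ B ∪ B' := by
      obtain ⟨γ, γ', a, b, c, h, rfl⟩ := hC
      rcases oneSided_or_exists_split h with hs | ⟨t, ht, -, h1, h2⟩
      · exact ⟨_, _, hone h hs, hone h hs, by simp⟩
      · refine ⟨_, _, hone (h.mono le_rfl ht.1 ht.2) h1, hone (h.mono ht.1 ht.2 le_rfl) h2, ?_⟩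
        rw [← image_union, ← image_union, Icc_union_Icc_eq_Icc ht.1 ht.2]
    obtain ⟨B, B', hB, hB', hsub⟩ := hstep
    obtain ⟨𝒞, hf, ht, hc⟩ := ih hB
    obtain ⟨𝒞', hf', ht', hc'⟩ := ih hB'
    refine ⟨𝒞 ∪ 𝒞', hf.union hf', fun D hD => hD.elim (ht D) (ht' D), ?_⟩
    rw [Function.iterate_succ, image_comp, sUnion_union]
    refine (image_mono hsub).trans ?_
    rw [image_union]
    exact union_subset_union hc hc'

/-- A sub-arc of the trace of an unstable curve is the trace of an unstable curve. -/
theorem exists_subcurve_of_image_subset (h : IsConeCurve S.Cu γ γ' a b c) {α : ℝ → Plane}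
    {s t : ℝ} (hst : s < t) (hα : ContinuousOn α (Icc s t)) (hinj : α s ≠ α t)
    (hsub : α '' Icc s t ⊆ γ '' Icc a b) :
    ∃ a' b', a' < b' ∧ IsConeCurve S.Cu γ γ' a' b' c ∧ γ '' Icc a' b' ⊆ α '' Icc s t := by
  have hfst := h.injOn_fst S.universal S.Cu_subset
  have hγ : ContinuousOn (fun t => γ t 0) (Icc a b) := by
    have := h.continuousOn
    fun_prop
  obtain ⟨τ, hτ, hτs⟩ := hsub (mem_image_of_mem α (left_mem_Icc.2 hst.le))
  obtain ⟨σ, hσ, hσt⟩ := hsub (mem_image_of_mem α (right_mem_Icc.2 hst.le))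
  have hne : τ ≠ σ := by
    rintro rfl
    exact hinj (hτs.symm.trans hσt)
  have hui : uIcc τ σ ⊆ Icc a b := ordConnected_Icc.uIcc_subset hτ hσ
  have hbetween : ∀ r ∈ uIcc τ σ, γ r 0 ∈ uIcc (γ τ 0) (γ σ 0) := fun r hr => by
    rcases hγ.strictMonoOn_of_injOn_Icc' h.le hfst with hm | hm
    · exact (hm.monotoneOn.mono hui).mapsTo_uIcc hr
    · exact (hm.antitoneOn.mono hui).mapsTo_uIcc hr
  -- The first coordinate of `α` takes all intermediate values, and on the trace of `γ` it
  -- determines the point.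
  have hcover : γ '' uIcc τ σ ⊆ α '' Icc s t := by
    rintro _ ⟨r, hr, rfl⟩
    have hαc : ContinuousOn (fun t => α t 0) (uIcc s t) := by
      rw [uIcc_of_le hst.le]
      fun_prop
    have hr' : γ r 0 ∈ uIcc (α s 0) (α t 0) := by
      rw [← hτs, ← hσt]
      exact hbetween r hr
    obtain ⟨q, hq, hq0⟩ := intermediate_value_uIcc hαc hr'
    rw [uIcc_of_le hst.le] at hq
    obtain ⟨r', hr'', hrq⟩ := hsub (mem_image_of_mem α hq)
    have : r' = r := hfst hr'' (hui hr) (by simp only [hrq]; exact hq0)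
    exact ⟨q, hq, by rw [← hrq, this]⟩
  rcases hne.lt_or_gt with hlt | hlt
  · rw [uIcc_of_le hlt.le] at hcover
    exact ⟨τ, σ, hlt, h.mono hτ.1 hlt.le hσ.2, hcover⟩
  · rw [uIcc_of_ge hlt.le] at hcover
    exact ⟨σ, τ, hlt, h.mono hσ.1 hlt.le hτ.2, hcover⟩

/-- By Baire's theorem, an arc covered by countably many unstable curves contains one. -/
theorem exists_curve_subset_of_countable_cover {A : Set Plane} (hA : IsArc A)
    {𝒞 : Set (Set Plane)} (hcount : 𝒞.Countable) (htr : ∀ B ∈ 𝒞, S.IsConeCurveTrace B)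
    (hcov : A ⊆ ⋃₀ 𝒞) :
    ∃ γ γ' a b c, a < b ∧ IsConeCurve S.Cu γ γ' a b c ∧ γ '' Icc a b ⊆ A := by
  obtain ⟨P, Q, α, hα, hinj, -, -, rfl⟩ := hA
  have : Countable 𝒞 := hcount.to_subtype
  have hclosed : ∀ B : 𝒞, IsClosed ((Icc (0 : ℝ) 1).domRestrict α ⁻¹' (B : Set Plane)) := by
    rintro ⟨B, hB⟩
    obtain ⟨γ, γ', a, b, c, h, rfl⟩ := htr B hB
    exact (isCompact_Icc.image_of_continuousOn h.continuousOn).isClosed.preimage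
      (continuousOn_iff_continuous_domRestrict.1 hα)
  have huniv : ⋃ B : 𝒞, (Icc (0 : ℝ) 1).domRestrict α ⁻¹' (B : Set Plane) = univ := by
    refine eq_univ_of_forall fun x => ?_
    obtain ⟨B, hB, hx⟩ := hcov (mem_image_of_mem α x.2)
    exact mem_iUnion.2 ⟨⟨B, hB⟩, hx⟩
  obtain ⟨⟨B, hB⟩, x, hx⟩ := nonempty_interior_of_iUnion_of_closed hclosed huniv
  obtain ⟨γ, γ', a, b, c, h, hγB⟩ := htr B hB
  obtain ⟨V, hV, hVeq⟩ := isOpen_induced_iff.1 (isOpen_interior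
    (s := (Icc (0 : ℝ) 1).domRestrict α ⁻¹' B))
  have hxV : (x : ℝ) ∈ V := by
    rw [← hVeq] at hx
    exact hx
  -- The interior point may be 0 or 1; it is moved into the open interval to make room on both
  -- sides.
  have hxcl : (x : ℝ) ∈ closure (Ioo (0 : ℝ) 1) := by
    rw [closure_Ioo zero_ne_one]
    exact x.2
  obtain ⟨y, hyV, hy⟩ := mem_closure_iff.1 hxcl V hV hxV
  obtain ⟨r, hr, hball⟩ := Metric.isOpen_iff.1 (hV.inter isOpen_Ioo) y ⟨hyV, hy⟩
  have hIcc : Icc (y - r / 2) (y + r / 2) ⊆ V ∩ Ioo 0 1 := fun z hz => by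
    refine hball ?_
    rw [Metric.mem_ball, Real.dist_eq, abs_lt]
    constructor <;> linarith [hz.1, hz.2]
  have hI : Icc (y - r / 2) (y + r / 2) ⊆ Icc 0 1 := fun z hz =>
    Ioo_subset_Icc_self (hIcc hz).2
  have hlt : y - r / 2 < y + r / 2 := by linarith
  have hsub : α '' Icc (y - r / 2) (y + r / 2) ⊆ γ '' Icc a b := by
    rintro _ ⟨z, hz, rfl⟩
    rw [hγB]
    have : (⟨z, hI hz⟩ : Icc (0 : ℝ) 1) ∈ interior ((Icc (0 : ℝ) 1).domRestrict α ⁻¹' B) := by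
      rw [← hVeq]
      exact (hIcc hz).1
    exact interior_subset (s := (Icc (0 : ℝ) 1).domRestrict α ⁻¹' B) this
  obtain ⟨a', b', hab, hc, hs⟩ := exists_subcurve_of_image_subset h hlt (hα.mono hI)
    (fun heq => hlt.ne (hinj (hI (left_mem_Icc.2 hlt.le)) (hI (right_mem_Icc.2 hlt.le)) heq)) hsub
  exact ⟨γ, γ', a', b', c, hab, hc, hs.trans (image_mono hI)⟩

/-- If no iterate of `A` contains a smooth arc joining the divider to its image, then the iterates
of `A` contain unstable curves that are arbitrarily long. -/
theorem exists_long_curve {A : Set Plane}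
    (hno : ¬∃ n : ℕ, ∃ A' : Set Plane, A' ⊆ S.map^[n] '' A ∧ IsSmoothArc A' ∧
      (A' ∩ S.divider).Nonempty ∧ (A' ∩ S.map '' S.divider).Nonempty)
    (h : IsConeCurve S.Cu γ γ' a b c) (hab : a < b) (hsub : γ '' Icc a b ⊆ A) (k : ℕ) :
    ∃ n : ℕ, ∃ δ δ' a' b' c', a' < b' ∧ IsConeCurve S.Cu δ δ' a' b' c' ∧
      δ '' Icc a' b' ⊆ S.map^[n] '' A ∧
      (min S.lam (S.lam ^ 2 / 2)) ^ k * (c * (b - a)) ≤ c' * (b' - a') := by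
  have hlam := S.lam_pos
  have hpush : ∀ {n : ℕ} {γ δ : ℝ → Plane} {a b : ℝ}, γ '' Icc a b ⊆ S.map^[n] '' A →
      (∀ t ∈ Icc a b, δ t = S.map (γ t)) → δ '' Icc a b ⊆ S.map^[n + 1] '' A := by
    intro n γ δ a b hsub heq
    rw [Function.iterate_succ', image_comp, image_congr heq, ← image_image S.map γ]
    exact image_mono hsub
  induction k with
  | zero => exact ⟨0, γ, γ', a, b, c, hab, h, by simpa using hsub, by simp⟩
  | succ k ih =>
    obtain ⟨n, γ₁, γ₁', a₁, b₁, c₁, hab₁, h₁, hsub₁, hlen⟩ := ih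
    -- The growth per round: `lam` for one step without a cut, `lam ^ 2 / 2` for two steps after one
    -- cut.
    set ρ := min S.lam (S.lam ^ 2 / 2) with hρ
    have hρ0 : 0 < ρ := lt_min hlam (by positivity)
    have hlen' : ρ ^ (k + 1) * (c * (b - a)) ≤ ρ * (c₁ * (b₁ - a₁)) := by
      rw [pow_succ', mul_assoc]
      gcongr
    have hba₁ : 0 < b₁ - a₁ := sub_pos.2 hab₁
    have hc₁ := h₁.pos
    rcases oneSided_or_exists_split h₁ with hs | ⟨t, ht, hdiv, hl, hr⟩
    · obtain ⟨δ, δ', hδ, heq⟩ := hs.exists_image h₁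
      refine ⟨n + 1, δ, δ', a₁, b₁, _, hab₁, hδ, hpush hsub₁ heq, hlen'.trans ?_⟩
      rw [mul_assoc]
      gcongr
      exact min_le_left _ _
    · have hhalf : ∃ a₂ b₂, a₁ ≤ a₂ ∧ a₂ ≤ t ∧ t ≤ b₂ ∧ b₂ ≤ b₁ ∧ (b₁ - a₁) / 2 ≤ b₂ - a₂ ∧
          S.OneSided γ₁ a₂ b₂ := by
        rcases le_total ((b₁ - a₁) / 2) (t - a₁) with h2 | h2
        · exact ⟨a₁, t, le_rfl, ht.1, le_rfl, ht.2, h2, hl⟩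
        · exact ⟨t, b₁, ht.1, le_rfl, ht.2, le_rfl, by linarith, hr⟩
      obtain ⟨a₂, b₂, ha, hat, htb, hb, hle, hs⟩ := hhalf
      have hab₂ : a₂ < b₂ := by linarith
      have h₂ := h₁.mono ha hab₂.le hb
      have hsub₂ : γ₁ '' Icc a₂ b₂ ⊆ S.map^[n] '' A :=
        (image_mono (Icc_subset_Icc ha hb)).trans hsub₁
      obtain ⟨δ, δ', hδ, heq⟩ := hs.exists_image h₂
      have hδsub := hpush hsub₂ heq
      have htI : t ∈ Icc a₂ b₂ := ⟨hat, htb⟩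
      -- The image of the cut point lies on the image of the divider, so by `hno` this piece cannot
      -- meet the divider.
      have hδs : S.OneSided δ a₂ b₂ := by
        refine oneSided_of_notMem hδ fun r hr hrdiv => hno ⟨n + 1, δ '' Icc a₂ b₂, hδsub,
          hδ.isSmoothArc S.universal S.Cu_subset hab₂, ⟨δ r, mem_image_of_mem δ hr, hrdiv⟩,
          ⟨δ t, mem_image_of_mem δ htI, ?_⟩⟩
        rw [heq t htI]
        exact mem_image_of_mem _ hdiv
      obtain ⟨η, η', hη, heq'⟩ := hδs.exists_image hδ
      refine ⟨n + 2, η, η', a₂, b₂, _, hab₂, hη, hpush hδsub heq', hlen'.trans ?_⟩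
      calc ρ * (c₁ * (b₁ - a₁)) ≤ S.lam ^ 2 / 2 * (c₁ * (b₁ - a₁)) := by
            gcongr
            exact min_le_right _ _
        _ = S.lam * (S.lam * c₁) * ((b₁ - a₁) / 2) := by ring
        _ ≤ _ := by gcongr

/-- The divider meets the unstable manifold of a fixed point of `F₂` on the divider only in this
fixed point, since its backward images are stretched. -/
theorem eq_of_mem_divider_of_mem_unstableManifold {X D : Plane} (hX : X ∈ S.divider)
    (hfix : S.F₂ X = X) (hD : D ∈ S.divider) (hDW : D ∈ unstableManifold S.F₂ X) : D = X := by
  obtain ⟨q, hq0, hq, hlim⟩ := hDW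
  -- The `n`-th preimage of the divider, parametrized by the original height, passes through `X` and
  -- `q n`.
  have hcurve : ∀ n : ℕ, ∃ c c' : ℝ → Plane, c (X 1) = X ∧ c (D 1) = q n ∧
      ∀ y, HasDerivAt c (c' y) y ∧ c' y ∈ (S.Cs.cone (c y)).carrier ∧ S.lam ^ n ≤ ‖c' y‖ := by
    intro n
    induction n with
    | zero =>
      refine ⟨fun y => !₂[S.g y, y], fun y => !₂[deriv S.g y, 1],
        (S.eq_of_mem_divider hX).symm, by rw [hq0]; exact (S.eq_of_mem_divider hD).symm,
        fun y => ⟨?_, S.tangent_s y, ?_⟩⟩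
      · have hpi : HasDerivAt (fun y => ![S.g y, y]) ![deriv S.g y, 1] y := by
          refine hasDerivAt_pi.2 fun i => ?_
          fin_cases i
          · exact (S.g_smooth.differentiable one_ne_zero y).hasDerivAt
          · exact hasDerivAt_id y
        exact (PiLp.hasFDerivAt_toLp (𝕜 := ℝ) (E := fun _ : Fin 2 => ℝ) 2 _).comp_hasDerivAt y hpi
      · simpa using PiLp.norm_apply_le (!₂[deriv S.g y, 1] : Plane) 1
    | succ n ih =>
      obtain ⟨c, c', hcX, hcD, hc⟩ := ih
      refine ⟨fun y => S.F₂.symm (c y), fun y => fderiv ℝ S.F₂.symm (c y) (c' y), ?_, ?_,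
        fun y => ⟨?_, S.hyp₂.map_s _ _ (hc y).2.1, ?_⟩⟩
      · change S.F₂.symm (c (X 1)) = X
        rw [hcX]
        conv_lhs => rw [← hfix]
        exact S.F₂.symm_apply_apply X
      · change S.F₂.symm (c (D 1)) = _
        rw [hcD, ← hq n]
        exact S.F₂.symm_apply_apply _
      · exact (PlaneDiffeo.differentiable S.F₂.symm (c y)).hasFDerivAt.comp_hasDerivAt y (hc y).1
      · have h1 := S.hyp₂.stretch_s _ _ (hc y).2.1
        have h2 := mul_le_mul_of_nonneg_left (hc y).2.2 S.lam_pos.le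
        rw [pow_succ']
        linarith
  -- Speed at least 1 in the stable cones already keeps `q n` at a fixed vertical distance from `X`
  -- unless `D` and `X` have equal height.
  have hbound : ∀ n : ℕ, S.Ks.coeff * |D 1 - X 1| ≤ ‖q n - X‖ := fun n => by
    obtain ⟨c, c', hcX, hcD, hc⟩ := hcurve n
    have hone : 1 ≤ S.lam ^ n := one_le_pow₀ S.one_lt_lam.le
    have hmvt : S.Ks.coeff * |D 1 - X 1| ≤ |c (D 1) 1 - c (X 1) 1| := by
      have key : ∀ u v : ℝ, u < v → S.Ks.coeff * |v - u| ≤ |c v 1 - c u 1| := by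
        intro u v huv
        obtain ⟨r, -, hr⟩ := exists_hasDerivAt_eq_slope (fun y => c y 1) (fun y => c' y 1) huv
          (fun y _ => ((hc y).1.plane_apply 1).continuousAt.continuousWithinAt)
          (fun y _ => (hc y).1.plane_apply 1)
        have hm := S.universal.mem_s_iff.1 (S.Cs_subset _ (hc r).2.1)
        have hvu : 0 < v - u := sub_pos.2 huv
        rw [hr, abs_div, le_div_iff₀ (abs_pos.2 hvu.ne')] at hm
        refine le_trans ?_ hm
        have h1 : 1 ≤ ‖c' r‖ := hone.trans (hc r).2.2
        have h2 := S.Ks.coeff_pos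
        gcongr
        exact le_mul_of_one_le_right h2.le h1
      rcases lt_trichotomy (X 1) (D 1) with hlt | heq | hlt
      · exact key _ _ hlt
      · simp [heq]
      · rw [abs_sub_comm, abs_sub_comm (c (D 1) 1)]
        exact key _ _ hlt
    rw [hcX, hcD] at hmvt
    exact hmvt.trans (PiLp.norm_apply_le (q n - X) 1)
  have hle : S.Ks.coeff * |D 1 - X 1| ≤ 0 :=
    ge_of_tendsto' (tendsto_iff_norm_sub_tendsto_zero.1 hlim) hbound
  have hz : D 1 = X 1 := by
    have h1 := S.Ks.coeff_pos
    have h2 := abs_nonneg (D 1 - X 1)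
    have : |D 1 - X 1| = 0 := by nlinarith
    exact sub_eq_zero.1 (abs_eq_zero.1 this)
  rw [S.eq_of_mem_divider hD, S.eq_of_mem_divider hX, hz]

end SynchronouslyHyperbolic

/-! ### The unstable manifold of the fixed point. -/

namespace LoziLike

variable {L : LoziLike} {X : Plane}

/-- On the divider, `X` would equal `D`, and the arc in (L3) would have coinciding endpoints. -/
theorem notMem_divider_of_L3 (hfix : L.map X = X) (hright : X ∈ L.rightHalfPlane)
    (hL3 : L.L3 X) : X ∉ L.divider := by
  intro hX
  obtain ⟨D, ⟨hD, hDW⟩, M, -, B, S, ⟨γ, -, hinj, h0, h1, -⟩, -⟩ := hL3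
  have hF₂ : L.F₂ X = X := by rw [← L.map_of_mem_right hright, hfix]
  have hDX := SynchronouslyHyperbolic.eq_of_mem_divider_of_mem_unstableManifold hX hF₂ hD hDW
  have h3 : L.map^[3] D = L.map D := by
    rw [hDX, Function.iterate_fixed hfix, hfix]
  exact zero_ne_one (hinj (by simp) (by simp) (h0.trans (h3.trans h1.symm)))

theorem image_closure_subset : L.map '' closure L.Δ ⊆ interior L.Δ := L.trapping.2

theorem map_iterate_mem_closure {P : Plane} (hP : P ∈ closure L.Δ) (n : ℕ) :
    L.map^[n] P ∈ closure L.Δ := by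
  induction n with
  | zero => exact hP
  | succ n ih =>
    rw [Function.iterate_succ_apply']
    exact subset_closure (interior_subset (image_closure_subset (mem_image_of_mem _ ih)))

theorem iterate_map_backward {f : Plane → Plane} {q : ℕ → Plane} (hq : ∀ n, f (q (n + 1)) = q n)
    (n : ℕ) : f^[n] (q n) = q 0 := by
  induction n with
  | zero => rfl
  | succ n ih => rw [Function.iterate_succ_apply, hq, ih]

/-- A backward orbit enters the interior of Δ, and forward iteration never leaves the closure. -/
theorem unstableManifold_subset (hXΔ : X ∈ L.Δ) (hfix : L.map X = X) :
    unstableManifold L.map X ⊆ closure L.Δ := by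
  rintro P ⟨q, rfl, hq, hlim⟩
  have hX : X ∈ interior L.Δ :=
    image_closure_subset ⟨X, subset_closure hXΔ, hfix⟩
  obtain ⟨n, hn⟩ := (hlim.eventually (isOpen_interior.mem_nhds hX)).exists
  rw [← iterate_map_backward hq n]
  exact map_iterate_mem_closure (subset_closure (interior_subset hn)) n

theorem exists_norm_le : ∃ R, ∀ P ∈ closure L.Δ, ‖P‖ ≤ R := by
  obtain ⟨e⟩ := L.closed_disk
  have : CompactSpace (Metric.closedBall (0 : Plane) 1) :=
    isCompact_iff_compactSpace.1 (isCompact_closedBall _ _)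
  have : CompactSpace (closure L.Δ) := e.symm.compactSpace
  exact (isCompact_iff_compactSpace.2 this).isBounded.exists_norm_le

/-- The unstable manifold of a fixed point off the divider is covered by countably many unstable
curves. -/
theorem exists_countable_cover (hfix : L.map X = X) (hright : X ∈ L.rightHalfPlane)
    (hX : X ∉ L.divider) :
    ∃ 𝒞 : Set (Set Plane), 𝒞.Countable ∧
      (∀ B ∈ 𝒞, L.toSynchronouslyHyperbolic.IsConeCurveTrace B) ∧
      unstableManifold L.map X ⊆ ⋃₀ 𝒞 := by
  have hF₂ : L.F₂ X = X := by rw [← L.map_of_mem_right hright, hfix]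
  obtain ⟨δ, hδ, ε, hε, γ, γ', hcont, hγ, hloc⟩ := L.hyp₂.exists_local_unstable_curve L.one_lt_lam
    L.universal L.Cu_subset L.Cs_subset hF₂ (L.det₂ X)
  obtain ⟨c, hc, hspeed⟩ : ∃ c > 0, ∀ t ∈ Icc (-δ) δ, c ≤ ‖γ' t‖ := by
    obtain ⟨t, ht, hmin⟩ := isCompact_Icc.exists_isMinOn
      (nonempty_Icc.2 (by linarith : -δ ≤ δ)) hcont.norm
    exact ⟨‖γ' t‖, norm_pos_iff.2 (hγ t ht).2.2, fun s hs => hmin hs⟩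
  have htrace : L.toSynchronouslyHyperbolic.IsConeCurveTrace (γ '' Icc (-δ) δ) :=
    ⟨γ, γ', -δ, δ, c, ⟨by linarith, hc, hcont, fun t ht => (hγ t ht).1,
      fun t ht => (hγ t ht).2.1, hspeed⟩, rfl⟩
  choose 𝒞 hfin htr hcov using fun N =>
    SynchronouslyHyperbolic.exists_finite_cover htrace N
  refine ⟨⋃ N, 𝒞 N, countable_iUnion fun N => (hfin N).countable, fun B hB => ?_, ?_⟩
  · obtain ⟨N, hN⟩ := mem_iUnion.1 hB
    exact htr N B hN
  · rintro P ⟨q, rfl, hq, hlim⟩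
    -- Near `X` the map is `F₂`, so a tail of the backward orbit is an orbit of `F₂` and starts on
    -- the local curve.
    have hlt : L.g (X 1) < X 0 := lt_of_le_of_ne hright fun h => hX h.symm
    have hnear : ∀ᶠ P : Plane in 𝓝 X, L.g (P 1) < P 0 := by
      have hg := L.g_smooth.continuous
      have h0 : Continuous fun P : Plane => P 0 := by fun_prop
      have h1 : Continuous fun P : Plane => L.g (P 1) := hg.comp (by fun_prop)
      exact h1.continuousAt.eventually_lt h0.continuousAt hlt
    obtain ⟨N, hN⟩ := eventually_atTop.1 (hlim.eventually
      (hnear.and (Metric.closedBall_mem_nhds X hε)))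
    have hmem : q N ∈ γ '' Icc (-δ) δ := by
      refine hloc (fun n => q (N + n)) (fun n => ?_) (fun n => ?_)
      · have := (hN (N + n) (Nat.le_add_right _ _)).2
        rwa [← dist_eq_norm]
      · have := (hN (N + (n + 1)) (Nat.le_add_right _ _)).1
        rw [← L.map_of_mem_right this.le]
        exact hq (N + n)
    have := hcov N (mem_image_of_mem _ hmem)
    rw [iterate_map_backward hq N] at this
    obtain ⟨B, hB, hPB⟩ := this
    exact ⟨B, mem_iUnion.2 ⟨N, hB⟩, hPB⟩

end LoziLike

theorem mainTheorem8 (L : LoziLike) (X : Plane) (hXΔ : X ∈ L.Δ) (hfix : L.map X = X)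
    (hright : X ∈ L.rightHalfPlane) (hL3 : L.L3 X) (hL4 : L.L4)
    (A : Set Plane) (hA : IsArc A) (hAW : A ⊆ unstableManifold L.map X) :
    ∃ n : ℕ, ∃ A' : Set Plane, A' ⊆ L.map^[n] '' A ∧ IsSmoothArc A' ∧
      (A' ∩ L.divider).Nonempty ∧ (A' ∩ L.map '' L.divider).Nonempty := by
  by_contra hno
  obtain ⟨𝒞, hcount, htr, hcov⟩ := LoziLike.exists_countable_cover hfix hright
    (LoziLike.notMem_divider_of_L3 hfix hright hL3)
  obtain ⟨γ, γ', a, b, c, hab, h, hsub⟩ :=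
    SynchronouslyHyperbolic.exists_curve_subset_of_countable_cover hA hcount htr (hAW.trans hcov)
  obtain ⟨R, hR⟩ := L.exists_norm_le
  set ρ := min L.lam (L.lam ^ 2 / 2) with hρ
  -- Condition (L4) says exactly that `lam ^ 2 / 2 > 1`.
  have hρ1 : 1 < ρ := by
    refine lt_min L.one_lt_lam ?_
    have := Real.lt_sq_of_sqrt_lt hL4
    linarith
  have hlen : 0 < c * (b - a) := mul_pos h.pos (sub_pos.2 hab)
  have hk := L.Ku.coeff_pos
  -- The horizontal extent is at most `2 * R` and at least `L.Ku.coeff` times the length bound.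
  obtain ⟨k, hkR⟩ := (((tendsto_pow_atTop_atTop_of_one_lt hρ1).atTop_mul_const
    hlen).eventually_gt_atTop (2 * R / L.Ku.coeff)).exists
  obtain ⟨n, δ, δ', a', b', c', hab', hδ, hδsub, hle⟩ :=
    SynchronouslyHyperbolic.exists_long_curve hno h hab hsub k
  have hbd : ∀ t ∈ Icc a' b', |δ t 0| ≤ R := fun t ht => by
    obtain ⟨P, hP, hPt⟩ := hδsub (mem_image_of_mem δ ht)
    rw [← hPt]
    exact (PiLp.norm_apply_le (L.map^[n] P) 0).trans (hR _ (LoziLike.map_iterate_mem_closure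
      (LoziLike.unstableManifold_subset hXΔ hfix (hAW hP)) n))
  have h1 := hδ.mul_le_abs_sub_fst L.universal L.Cu_subset hab'
  have h2 := abs_sub (δ b' 0) (δ a' 0)
  have h3 := hbd a' (left_mem_Icc.2 hab'.le)
  have h4 := hbd b' (right_mem_Icc.2 hab'.le)
  rw [div_lt_iff₀ hk] at hkR
  have h5 := mul_le_mul_of_nonneg_left hle hk.le
  linarith
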